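/- Let $\mathcal A$ be a complex Banach algebra (not necessarily unital). Its dual $\mathcal A'$ is an $\mathcal A$-bimodule via $\langle a\cdot\mu,b\rangle=\langle\mu,ba\rangle$ and $\langle\mu\cdot a,b\rangle=\langle\mu,ab\rangle$. Let $\mathcal A_*\subseteq\mathcal A'$ be a closed sub-bimodule such that the canonical map $\mathcal A\to(\mathcal A_*)'$, $a\mapsto(\mu\mapsto\langle\mu,a\rangle)$, is an isomorphism of Banach spaces (not necessarily isometric); that is, $(\mathcal A,\mathcal A_*)$ is a dual Banach algebra. The weak$^*$-topology of $\mathcal A$ is the topology $\sigma(\mathcal A,\mathcal A_*)$. An involution on a Banach algebra means a norm-continuous, conjugate-linear map $a\mapsto a^*$ with $(ab)^*=b^*a^*$ and $a^{**}=a$. For a reflexive Banach space $E$, the weak$^*$-topology of the algebra $\mathcal B(E)$ of bounded operators is the one given by its canonical predual $E'\widehat\otimes E$ (projective tensor product), that is, the coarsest topology for which all functionals $T\mapsto\sum_{n}\langle\lambda_n,T x_n\rangle$, with $\lambda_n\in E'$, $x_n\in E$ and $\sum_n\|\lambda_n\|\|x_n\|<\infty$, are continuous. Suppose that $\mathcal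 A$ carries an involution. Then the following are equivalent: 1. the involution of $\mathcal A$ is weak$^*$-continuous; 2. there are a reflexive Banach space $E$, an involution on $\mathcal B(E)$, and a weak$^*$-continuous $*$-homomorphism $\pi:\mathcal A\to\mathcal B(E)$ which is a homeomorphism, for the norm topologies, onto a norm-closed subalgebra of $\mathcal B(E)$; 3. there are $E$, an involution on $\mathcal B(E)$ and $\pi$ as in (2) such that in addition the involution of $\mathcal B(E)$ comes from a bounded nondegenerate sesquilinear form: there is a bounded sesquilinear form $[\cdot,\cdot]$ on $E$ (linear in the first variable, conjugate-linear in the second) for which the conjugate-linear map $J:E\to E'$, $\langle J(y),x\rangle=[x,y]$, is a homeomorphism, and $[T^*x,y]=[x,Ty]$ for all $T\in\mathcal B(E)$ and $x,y\in E$. -/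

import Mathlib

open scoped ComplexConjugate Topology

universe u

section Algebra

variable {A : Type u} [NonUnitalNormedRing A] [NormedSpace ℂ A] [IsScalarTower ℂ A A]
  [SMulCommClass ℂ A A]

/-- The left module action on the dual of a Banach algebra: `⟨a · μ, b⟩ = ⟨μ, b a⟩`. -/
noncomputable def dualLeftAct (a : A) (μ : StrongDual ℂ A) : StrongDual ℂ A :=
  μ.comp ((ContinuousLinearMap.mul ℂ A).flip a)

/-- The right module action on the dual of a Banach algebra: `⟨μ · a, b⟩ = ⟨μ, a b⟩`. -/
noncomputable def dualRightAct (μ : StrongDual ℂ A) (a : A) : StrongDual ℂ A :=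
  μ.comp (ContinuousLinearMap.mul ℂ A a)

/-- The canonical map `A → P'` for a subspace `P` of `A'`: the composite of `κ_A : A → A''` with
the restriction map `A'' → P'`. -/
noncomputable def toDualOfSubspace (P : Submodule ℂ (StrongDual ℂ A)) (a : A) : StrongDual ℂ P :=
  (NormedSpace.inclusionInDoubleDual ℂ A a).comp P.subtypeL

/-- `(A, P)` is a dual Banach algebra with predual `P`: `P` is a closed sub-bimodule of `A'` and
the canonical bounded linear map `A → P'` is an isomorphism. For a Banach space `A`, bijectivity
suffices here, by the open mapping theorem. -/
structure IsDualBanachAlgebra (P : Submodule ℂ (StrongDual ℂ A)) : Prop where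
  isClosed : IsClosed (P : Set (StrongDual ℂ A))
  left_mem : ∀ (a : A), ∀ μ ∈ P, dualLeftAct a μ ∈ P
  right_mem : ∀ (a : A), ∀ μ ∈ P, dualRightAct μ a ∈ P
  bijective : Function.Bijective (toDualOfSubspace P)

end Algebra

section WeakStar

variable {X : Type u} [NormedAddCommGroup X] [NormedSpace ℂ X]

/-- The topology `σ(X, P)` on `X` defined by a set `P` of bounded functionals: the coarsest
topology for which every member of `P` is continuous. When `P` is the predual of `X`, this is the
weak-star topology of `X`. -/
noncomputable abbrev weakStarTopology (P : Set (StrongDual ℂ X)) : TopologicalSpace X :=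
  ⨅ μ ∈ P, TopologicalSpace.induced (fun x : X => μ x) inferInstance

end WeakStar

section Operators

variable (E : Type u) [NormedAddCommGroup E] [NormedSpace ℂ E]

/-- A normed space is reflexive when the canonical map `κ_E : E → E''` is onto. -/
def IsReflexiveSpace : Prop :=
  Function.Surjective (NormedSpace.inclusionInDoubleDual ℂ E)

/-- The canonical predual of `B(E)`, for `E` reflexive: the image in `B(E)'` of the projective
tensor product of `E'` and `E`. The members of that tensor product are exactly the sums of series
`∑ λₙ ⊗ xₙ` with `∑ ‖λₙ‖ ‖xₙ‖ < ∞`, and such a member acts by `T ↦ ∑ ⟨λₙ, T xₙ⟩`. -/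
def operatorPredual : Set (StrongDual ℂ (E →L[ℂ] E)) :=
  {φ | ∃ (l : ℕ → StrongDual ℂ E) (x : ℕ → E),
    Summable (fun n => ‖l n‖ * ‖x n‖) ∧
      ∀ T : E →L[ℂ] E, HasSum (fun n => l n (T (x n))) (φ T)}

end Operators

/-! Weak-star continuous functionals are exactly the members of the predual `P`, so the involution
is weak-star continuous if and only if `P` is stable under `starDual`, that is, under `μ ↦ conj ⟨μ,
a*⟩` (`continuous_star_weakStar_iff`).

From a representation to continuity: coefficients `a ↦ ⟨l, π(a) x⟩` lie in `P`. An involution of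
`B(E)` takes rank-one idempotents to rank-one idempotents, hence carries vector functionals of
`B(E)` to vector functionals (`exists_conj_apply_star`), so `starDual` permutes the coefficients.
Only `a = 0` kills them all, as `π` is injective; since `A` is the dual of `P`, they span a
norm-dense subspace of `P`, and stability extends by continuity.

From continuity to a representation: `W = P × ℂ` is the predual of the unitization of `A`. Each `μ`
in `P` gives an orbit map `W' → W`, `f ↦ f · (μ, 0)`. Its transpose sends `W'` into `W`, because the
dual actions preserve `P`; this is a form of weak compactness. Davis-Figiel-Johnson-Pełczyński
interpolation of all orbit maps with `‖μ‖ ≤ 1` gives one reflexive space `F` on which `A` acts,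
bounded below and with coefficients in `P` (`IsDualBanachAlgebra.exists_reflexive_representation`).
Then `E` is `F` plus its conjugate dual, with the canonical Hermitian form, and `a` acts by `ρ(a)`
on `F` and by the transpose of `ρ(a*)` on the second summand (`exists_involutive_representation`).
The new coefficients involve `starDual`, which is where stability of `P` enters. -/

section WeakStarContinuity

variable {X : Type u} [NormedAddCommGroup X] [NormedSpace ℂ X]

/-- A linear functional continuous for `σ(X, P)` belongs to `P`. -/
theorem exists_mem_eq_of_continuous_weakStar (P : Submodule ℂ (StrongDual ℂ X)) (φ : X →ₗ[ℂ] ℂ)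
    (h : Continuous[weakStarTopology (P : Set (StrongDual ℂ X)), inferInstance] φ) :
    ∃ μ ∈ P, ∀ x, φ x = μ x := by
  have key := (LinearMap.mem_span_iff_continuous
    (f := fun μ : P => ((μ : StrongDual ℂ X) : X →ₗ[ℂ] ℂ)) φ).2 (by
      have e : weakStarTopology (P : Set (StrongDual ℂ X)) =
          ⨅ i : P, TopologicalSpace.induced
            (((i : StrongDual ℂ X) : X →ₗ[ℂ] ℂ) : X → ℂ) inferInstance := by
        rw [weakStarTopology, iInf_subtype]; rfl
      rw [← e]; exact h)
  have hle : Submodule.span ℂ (Set.range fun μ : P => ((μ : StrongDual ℂ X) : X →ₗ[ℂ] ℂ)) ≤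
      P.map (ContinuousLinearMap.coeLM ℂ) := by
    rw [Submodule.span_le]
    rintro _ ⟨μ, rfl⟩
    exact ⟨μ, μ.2, rfl⟩
  obtain ⟨μ, hμ, e⟩ := hle key
  exact ⟨μ, hμ, fun x => by rw [← e]; rfl⟩

theorem continuous_weakStar_apply {S : Set (StrongDual ℂ X)} {μ : StrongDual ℂ X} (hμ : μ ∈ S) :
    Continuous[weakStarTopology S, inferInstance] (fun x => μ x) :=
  continuous_iff_le_induced.2 (iInf₂_le μ hμ)

theorem continuous_weakStar_iff {X Y : Type u} [NormedAddCommGroup Y] [NormedSpace ℂ Y]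
    {t : TopologicalSpace X} {S : Set (StrongDual ℂ Y)} {f : X → Y} :
    Continuous[t, weakStarTopology S] f ↔
      ∀ φ ∈ S, Continuous[t, inferInstance] (fun x => φ (f x)) := by
  simp only [continuous_iInf_rng, continuous_induced_rng]
  rfl

end WeakStarContinuity

/-! ### Hahn-Banach density and a compactness criterion for reflexivity -/

section Density

variable {X : Type u} [NormedAddCommGroup X] [NormedSpace ℂ X]

theorem topologicalClosure_eq_top_of_dual (N : Submodule ℂ X)
    (h : ∀ f : StrongDual ℂ X, (∀ x ∈ N, f x = 0) → f = 0) : N.topologicalClosure = ⊤ := by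
  by_contra hne
  obtain ⟨x, hx⟩ : ∃ x, x ∉ N.topologicalClosure := by
    by_contra! H
    exact hne (eq_top_iff.2 fun x _ => H x)
  have : IsClosed (N.topologicalClosure : Set X) := N.isClosed_topologicalClosure
  have hq : N.topologicalClosure.mkQL x ≠ 0 := by
    simpa using hx
  obtain ⟨g, -, hg⟩ := exists_dual_vector ℂ _ (norm_ne_zero_iff.2 hq)
  have h0 : g.comp N.topologicalClosure.mkQL = 0 := h _ fun y hy => by
    have : N.topologicalClosure.mkQL y = 0 := by
      simpa using N.le_topologicalClosure hy
    simp [ContinuousLinearMap.comp_apply, this]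
  have h1 := DFunLike.congr_fun h0 x
  rw [ContinuousLinearMap.comp_apply, hg] at h1
  exact hq (by simpa using h1)

theorem eq_top_of_isClosed_of_dual (N : Submodule ℂ X) (hN : IsClosed (N : Set X))
    (h : ∀ f : StrongDual ℂ X, (∀ x ∈ N, f x = 0) → f = 0) : N = ⊤ := by
  rw [← topologicalClosure_eq_top_of_dual N h, hN.submodule_topologicalClosure_eq]

end Density

section Reflexivity

variable {F : Type u} [NormedAddCommGroup F] [NormedSpace ℂ F]

/-- Separation of a point from a closed convex set in the weak-star topology. -/
theorem exists_re_lt_of_notMem_weakDual {s : Set (WeakDual ℂ F)} (hs : Convex ℝ s)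
    (hc : IsClosed s) {x : WeakDual ℂ F} (hx : x ∉ s) :
    ∃ (g : F) (u : ℝ), (∀ a ∈ s, RCLike.re (a g) < u) ∧ u < RCLike.re (x g) := by
  have h1 : IsScalarTower ℝ ℂ (WeakDual ℂ F) :=
    ⟨fun a b f => DFunLike.ext _ _ fun x => smul_assoc a b (f x)⟩
  have h2 : LocallyConvexSpace ℝ (WeakDual ℂ F) :=
    (WeakDual.withSeminorms (𝕜 := ℂ) (E := F)).toLocallyConvexSpace
  obtain ⟨h, u, h1, h2⟩ := @RCLike.geometric_hahn_banach_closed_point ℂ (WeakDual ℂ F)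
    _ _ _ s x _ _ h1 _ _ h2 hs hc hx
  obtain ⟨g, hg⟩ := LinearMap.dualEmbedding_surjective (topDualPairing ℂ F) h
  subst hg
  exact ⟨g, u, h1, h2⟩

/-- Goldstine's theorem. -/
theorem mem_closure_image_inclusionInDoubleDual {Φ : StrongDual ℂ (StrongDual ℂ F)}
    (hΦ : ‖Φ‖ ≤ 1) :
    StrongDual.toWeakDual Φ ∈ closure ((fun x =>
      StrongDual.toWeakDual (NormedSpace.inclusionInDoubleDual ℂ F x)) ''
        Metric.closedBall (0 : F) 1) := by
  let L : F →ₗ[ℂ] WeakDual ℂ (StrongDual ℂ F) :=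
    StrongDual.toWeakDual.toLinearMap ∘ₗ (NormedSpace.inclusionInDoubleDual ℂ F).toLinearMap
  by_contra hn
  have hconv : Convex ℝ (L '' Metric.closedBall (0 : F) 1) := by
    rintro _ ⟨x, hx, rfl⟩ _ ⟨y, hy, rfl⟩ a b ha hb hab
    refine ⟨a • x + b • y, convex_closedBall (0 : F) 1 hx hy ha hb hab, ?_⟩
    refine DFunLike.ext _ _ fun g => ?_
    change g (a • x + b • y) = a • g x + b • g y
    simp
  obtain ⟨g, u, h1, h2⟩ := exists_re_lt_of_notMem_weakDual
    (@Convex.closure ℝ (WeakDual ℂ (StrongDual ℂ F)) _ _ _ _ _ _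
      (WeakDual.instContinuousConstSMul ℝ) _ hconv) isClosed_closure hn
  have hlt : ∀ x : F, ‖x‖ ≤ 1 → RCLike.re (g x) < u := fun x hx => by
    exact h1 (L x) (subset_closure ⟨x, by simpa using hx, rfl⟩)
  have hu : 0 < u := by simpa using hlt 0 (by simp)
  have hnorm : ‖g‖ ≤ u := by
    refine ContinuousLinearMap.opNorm_le_of_unit_norm (𝕜 := ℂ) hu.le fun x hx => ?_
    by_contra! hc
    have hne : ‖g x‖ ≠ 0 := (hu.trans hc).ne'
    -- Rotating `x` by a phase makes `g x` real and positive, so a bound on real parts bounds the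
    -- norm.
    have := hlt ((conj (g x) / ‖g x‖) • x) (by
      rw [norm_smul, hx]; simp [div_self hne])
    rw [map_smul, smul_eq_mul, div_mul_eq_mul_div, Complex.conj_mul', sq,
      mul_div_assoc, div_self (by exact_mod_cast hne), mul_one] at this
    simp only [RCLike.re_to_complex, Complex.ofReal_re] at this
    linarith
  have h3 : RCLike.re (Φ g) ≤ ‖g‖ := (RCLike.re_le_norm _).trans (by
    simpa using Φ.le_of_opNorm_le hΦ g)
  have h4 : u < RCLike.re (Φ g) := h2
  linarith

/-- A space whose unit ball is covered by the image of a compact space under a map that is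
continuous for a total family of functionals is reflexive. -/
theorem isReflexiveSpace_of_compact {Q : Type*} [TopologicalSpace Q] [CompactSpace Q] (θ : Q → F)
    (hθ : Metric.closedBall (0 : F) 1 ⊆ Set.range θ) (G : Submodule ℂ (StrongDual ℂ F))
    (hG : G.topologicalClosure = ⊤) (hc : ∀ g ∈ G, Continuous fun q => g (θ q)) :
    IsReflexiveSpace F := by
  have key : ∀ Φ : StrongDual ℂ (StrongDual ℂ F), ‖Φ‖ ≤ 1 →
      ∃ x, NormedSpace.inclusionInDoubleDual ℂ F x = Φ := by
    intro Φ hΦ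
    let ev : WeakDual ℂ (StrongDual ℂ F) → (G → ℂ) := fun Ψ g => Ψ (g : StrongDual ℂ F)
    have hev : Continuous ev := continuous_pi fun g => WeakDual.eval_continuous _
    -- Restricted to `G`, the values of `θ` form a compact set, which by Goldstine also contains the
    -- restriction of `Φ`; density of `G` then identifies `Φ` itself.
    have hK : IsClosed (Set.range fun q => fun g : G => (g : StrongDual ℂ F) (θ q)) :=
      (isCompact_range (continuous_pi fun g : G => hc g.1 g.2)).isClosed
    have hmem : ev (StrongDual.toWeakDual Φ) ∈
        Set.range fun q => fun g : G => (g : StrongDual ℂ F) (θ q) := by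
      refine closure_minimal ?_ (hK.preimage hev) (mem_closure_image_inclusionInDoubleDual hΦ)
      rintro _ ⟨x, hx, rfl⟩
      obtain ⟨q, rfl⟩ := hθ hx
      exact ⟨q, rfl⟩
    obtain ⟨q, hq⟩ := hmem
    refine ⟨θ q, ?_⟩
    have hcl : IsClosed {g : StrongDual ℂ F | g (θ q) = Φ g} :=
      isClosed_eq (by fun_prop) Φ.continuous
    have hsub : (G : Set (StrongDual ℂ F)) ⊆ {g | g (θ q) = Φ g} := fun g hg =>
      congr_fun hq ⟨g, hg⟩
    refine ContinuousLinearMap.ext fun g => ?_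
    have : g ∈ G.topologicalClosure := hG ▸ Submodule.mem_top
    exact closure_minimal hsub hcl this
  intro Φ
  obtain ⟨x, hx⟩ := key (((‖Φ‖ + 1 : ℝ) : ℂ)⁻¹ • Φ) (by
    refine (ContinuousLinearMap.opNorm_smul_le _ Φ).trans ?_
    rw [norm_inv, Complex.norm_real, Real.norm_of_nonneg (by positivity),
      inv_mul_le_one₀ (by positivity)]
    linarith)
  refine ⟨((‖Φ‖ + 1 : ℝ) : ℂ) • x, ?_⟩
  have : ((‖Φ‖ + 1 : ℝ) : ℂ) ≠ 0 := by
    exact_mod_cast (by positivity : (‖Φ‖ + 1 : ℝ) ≠ 0)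
  rw [map_smul, hx, smul_inv_smul₀ this]

end Reflexivity

/-! ### Functionals on an `ℓ²`-sum -/

section SquareSummable

variable {ι : Type*} [DecidableEq ι] {G : ι → Type u} [∀ i, NormedAddCommGroup (G i)]
  [∀ i, NormedSpace ℂ (G i)]

theorem memℓp_dual_single (f : StrongDual ℂ (lp G 2)) :
    Memℓp (fun i => f.comp (lp.singleContinuousLinearMap ℂ G 2 i)) 2 := by
  have hx : ∀ i, ∃ x : G i, ‖x‖ ≤ 1 ∧ ∃ r : ℝ,
      f (lp.single 2 i x) = r ∧ ‖f.comp (lp.singleContinuousLinearMap ℂ G 2 i)‖ / 2 ≤ r := by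
    intro i
    set g := f.comp (lp.singleContinuousLinearMap ℂ G 2 i)
    by_cases hg : ‖g‖ = 0
    · exact ⟨0, by simp, 0, by simp, by simp [hg]⟩
    have hpos : 0 < ‖g‖ := lt_of_le_of_ne (norm_nonneg _) (Ne.symm hg)
    obtain ⟨x, hx1, hx2⟩ := g.exists_lt_apply_of_lt_opNorm (half_lt_self hpos)
    have hne : ‖g x‖ ≠ 0 := ((half_pos hpos).trans hx2).ne'
    refine ⟨(conj (g x) / ‖g x‖) • x, ?_, ‖g x‖, ?_, hx2.le⟩
    · rw [norm_smul]; simp [div_self hne, hx1.le]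
    · change g _ = _
      rw [map_smul, smul_eq_mul, div_mul_eq_mul_div, Complex.conj_mul', sq,
        mul_div_assoc, div_self (by exact_mod_cast hne), mul_one]
  choose x hx1 r hr hr2 using hx
  refine memℓp_gen' (C := (2 * ‖f‖) ^ 2) fun s => ?_
  set c : ι → ℝ := fun i => ‖f.comp (lp.singleContinuousLinearMap ℂ G 2 i)‖ with hc
  have hc0 : ∀ i, 0 ≤ c i := fun i => norm_nonneg _
  have hpow : ∀ i, c i ^ (2 : ENNReal).toReal = c i ^ 2 := fun i => by simp
  change ∑ i ∈ s, c i ^ (2 : ENNReal).toReal ≤ _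
  simp only [hpow]
  set S := ∑ i ∈ s, c i ^ 2 with hS
  have hS0 : 0 ≤ S := Finset.sum_nonneg fun i _ => sq_nonneg _
  -- Test vector for `ℓ²`-duality: each `x i` norms its coordinate functional up to a factor 2, so
  -- `S / 2 ≤ ‖f‖ ‖z‖ ≤ ‖f‖ √S`, whence `S ≤ (2‖f‖)²`.
  set z : lp G 2 := ∑ i ∈ s, lp.single 2 i ((c i : ℂ) • x i) with hz
  have hzn : ‖z‖ ^ 2 ≤ S := by
    have := lp.norm_sum_single (E := G) (p := 2) (by simp) (fun i => (c i : ℂ) • x i) s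
    simp only [ENNReal.toReal_ofNat, Real.rpow_ofNat] at this
    rw [hz, this]
    refine Finset.sum_le_sum fun i _ => ?_
    gcongr
    rw [norm_smul, Complex.norm_real, Real.norm_of_nonneg (hc0 i)]
    exact mul_le_of_le_one_right (hc0 i) (hx1 i)
  have hfz : f z = ((∑ i ∈ s, c i * r i : ℝ) : ℂ) := by
    rw [hz, map_sum, Complex.ofReal_sum]
    refine Finset.sum_congr rfl fun i _ => ?_
    rw [lp.single_smul, map_smul, hr, smul_eq_mul, Complex.ofReal_mul]
  have hle : S / 2 ≤ ‖f‖ * ‖z‖ := by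
    calc S / 2 ≤ ∑ i ∈ s, c i * r i := by
          rw [hS, Finset.sum_div]
          refine Finset.sum_le_sum fun i _ => ?_
          nlinarith [hc0 i, hr2 i]
      _ ≤ ‖f z‖ := by rw [hfz, Complex.norm_real]; exact le_abs_self _
      _ ≤ _ := f.le_opNorm z
  nlinarith [norm_nonneg f, norm_nonneg z, sq_nonneg (‖f‖ - ‖z‖), sq_nonneg (2 * ‖f‖ - ‖z‖)]

/-- A bounded functional on an `ℓ²`-sum is the norm-convergent sum of its coordinate functionals. -/
theorem hasSum_dual_single (f : StrongDual ℂ (lp G 2)) :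
    HasSum (fun i => (f.comp (lp.singleContinuousLinearMap ℂ G 2 i)).comp (lp.evalCLM ℂ G 2 i))
      f := by
  let Fd : lp (fun i => StrongDual ℂ (G i)) 2 := ⟨_, memℓp_dual_single f⟩
  let B := lp.dualPairing (𝕜 := ℂ) 2 2 (E := fun i => StrongDual ℂ (G i)) (F := G) (H := ℂ)
    (fun i => ContinuousLinearMap.id ℂ (StrongDual ℂ (G i))) (K := 1)
    (fun i => by simpa using ContinuousLinearMap.norm_id_le)
  have h1 := (lp.hasSum_single (p := 2) (by simp) Fd).mapL B
  have h2 : ∀ (i : ι) (g : StrongDual ℂ (G i)),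
      B (lp.single 2 i g) = g.comp (lp.evalCLM ℂ G 2 i) := by
    intro i g
    ext z
    rw [lp.dualPairing_apply, tsum_eq_single i]
    · simp [lp.evalCLM]
    · intro j hj
      simp [Pi.single_eq_of_ne hj]
  simp only [h2] at h1
  have h3 : B Fd = f := by
    ext z
    have e1 : HasSum (fun i => f (lp.single 2 i (z i))) (f z) :=
      (lp.hasSum_single (p := 2) (by simp) z).mapL f
    rw [← e1.tsum_eq, lp.dualPairing_apply]
    rfl
  rwa [h3] at h1

end SquareSummable

/-! ### Involutions of `B(E)` and rank-one operators -/

section OperatorInvolution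

variable {E : Type u} [NormedAddCommGroup E] [NormedSpace ℂ E]
  [StarRing (E →L[ℂ] E)] [StarModule ℂ (E →L[ℂ] E)]

/-- An involution of `B(E)` maps some rank-one idempotent to a rank-one idempotent. -/
theorem exists_star_rankOne_eq [Nontrivial E] : ∃ (l m : StrongDual ℂ E) (e f : E),
    l e = 1 ∧ m f = 1 ∧ star (l.smulRight e) = m.smulRight f := by
  obtain ⟨e, he⟩ := exists_ne (0 : E)
  obtain ⟨l, hl⟩ := SeparatingDual.exists_eq_one (R := ℂ) he
  set p : E →L[ℂ] E := l.smulRight e with hp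
  have hpTp : ∀ T : E →L[ℂ] E, p * T * p = l (T e) • p := by
    intro T
    ext z
    simp [hp, smul_smul, mul_comm]
  have hp0 : p ≠ 0 := fun h => he (by
    have := DFunLike.congr_fun h e
    simpa [hp, hl] using this)
  have hpp : p * p = p := by
    have := hpTp 1
    rwa [mul_one, one_apply_eq_self, hl, one_smul] at this
  set q := star p with hq
  have hqq : q * q = q := by rw [hq, ← star_mul, hpp]
  -- Minimality, `p B(E) p = ℂ p`, is an algebraic property and so passes to `q = p*`; testing it on
  -- rank-one `T` forces `q` to have rank one.
  have hqTq : ∀ T : E →L[ℂ] E, ∃ c : ℂ, q * T * q = c • q := by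
    intro T
    refine ⟨star (l (star T e)), ?_⟩
    rw [hq, ← star_smul, ← hpTp, star_mul, star_mul, star_star, mul_assoc]
  obtain ⟨z, hz⟩ : ∃ z, q z ≠ 0 := by
    by_contra! H
    exact hp0 (star_eq_zero.1 (ContinuousLinearMap.ext H))
  obtain ⟨g, hg⟩ := SeparatingDual.exists_eq_one (R := ℂ) hz
  set f := q z with hf
  have hqf : q f = f := by
    rw [hf, ← mul_apply_eq_comp, hqq]
  have hrange : ∀ y, q y = g (q y) • f := by
    intro y
    obtain ⟨c, hc⟩ := hqTq (g.smulRight y)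
    have h1 := DFunLike.congr_fun hc f
    simp only [mul_apply_eq_comp, hqf, ContinuousLinearMap.smulRight_apply, hg,
      one_smul, smul_apply] at h1
    rw [h1, map_smul, hg, smul_eq_mul, mul_one]
  refine ⟨l, g.comp q, e, f, hl, ?_, ?_⟩
  · rw [ContinuousLinearMap.comp_apply, hqf, hg]
  · ext y
    rw [ContinuousLinearMap.smulRight_apply, ContinuousLinearMap.comp_apply, ← hrange]

/-- For a continuous involution of `B(E)`, the functional `T ↦ conj ⟨l, T* x⟩` has rank one. -/
theorem exists_conj_apply_star [ContinuousStar (E →L[ℂ] E)] (l : StrongDual ℂ E) (x : E) :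
    ∃ (k : StrongDual ℂ E) (y : E), ∀ T : E →L[ℂ] E, conj (l (star T x)) = k (T y) := by
  cases subsingleton_or_nontrivial E
  · exact ⟨0, 0, fun T => by simp [Subsingleton.elim (star T x) 0]⟩
  obtain ⟨n, m, e, f, hn, hm, hstar⟩ := exists_star_rankOne_eq (E := E)
  have hstar' : star (m.smulRight f) = n.smulRight e := by rw [← hstar, star_star]
  set y : E := star (l.smulRight f) e with hy
  have hly : star (n.smulRight y) = l.smulRight f := by
    have h1 : l.smulRight f = m.smulRight f * l.smulRight f := by
      ext z; simp [hm]
    have h2 : star (l.smulRight f) = n.smulRight y := by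
      have h3 : star (l.smulRight f) = star (l.smulRight f) * n.smulRight e := by
        rw [← hstar', ← star_mul, ← h1]
      rw [h3]
      ext z
      simp [hy]
    rw [← h2, star_star]
  -- The operators `n ⊗ z` form a left ideal isomorphic to `E`, and `star (n ⊗ y) = l ⊗ f`. Hence
  -- `star (n ⊗ T y) = (l ⊗ f) T*`, from which `m` reads off `⟨l, T* x⟩` since `m f = 1`.
  let k : StrongDual ℂ E :=
    { toFun := fun z => conj (m (star (n.smulRight z) x))
      map_add' := fun z w => by
        have : n.smulRight (z + w) = n.smulRight z + n.smulRight w := by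
          ext; simp
        simp [this]
      map_smul' := fun c z => by
        have : n.smulRight (c • z) = c • n.smulRight z := by
          ext; simp [smul_smul, mul_comm]
        simp [this, star_smul]
      cont := by
        have h1 : Continuous fun z => ContinuousLinearMap.smulRightL ℂ E E n z :=
          ContinuousLinearMap.continuous _
        have h2 : Continuous fun z : E => star (n.smulRight z) := h1.star
        exact Complex.continuous_conj.comp (m.continuous.comp (h2.clm_apply continuous_const)) }
  refine ⟨k, y, fun T => ?_⟩
  have h4 : n.smulRight (T y) = T * n.smulRight y := by
    ext z; simp
  change _ = conj (m (star (n.smulRight (T y)) x))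
  rw [h4, star_mul, hly]
  simp [hm]

end OperatorInvolution

theorem rankOne_mem_operatorPredual {E : Type u} [NormedAddCommGroup E] [NormedSpace ℂ E]
    (l : StrongDual ℂ E) (x : E) :
    l.comp (ContinuousLinearMap.apply ℂ E x) ∈ operatorPredual E := by
  refine ⟨fun n => if n = 0 then l else 0, fun _ => x, ?_, fun T => ?_⟩
  · refine summable_of_ne_finset_zero (s := {0}) fun n hn => ?_
    rw [Finset.mem_singleton] at hn
    simp [hn]
  · convert! hasSum_single (0 : ℕ) (f := fun n => (if n = 0 then l else 0 : StrongDual ℂ E) (T x))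
      fun n hn => ?_ using 1
    simp [hn]

/-! ### Stability of the predual under the involution -/

section StarDual

variable {A : Type u} [NonUnitalNormedRing A] [NormedSpace ℂ A]
  [StarRing A] [StarModule ℂ A] [ContinuousStar A]

/-- The functional `a ↦ conj ⟨μ, a*⟩`. -/
noncomputable def starDual (μ : StrongDual ℂ A) : StrongDual ℂ A where
  toFun a := conj (μ (star a))
  map_add' a b := by simp
  map_smul' c a := by simp [star_smul]
  cont := Complex.continuous_conj.comp (μ.continuous.comp continuous_star)

@[simp]
theorem starDual_apply (μ : StrongDual ℂ A) (a : A) : starDual μ a = conj (μ (star a)) := rfl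

theorem continuous_starDual : Continuous (starDual : StrongDual ℂ A → StrongDual ℂ A) := by
  refine (LipschitzWith.of_dist_le_mul
    (K := ‖((starL ℂ : A ≃L⋆[ℂ] A) : A →L⋆[ℂ] A)‖₊) fun μ ν => ?_).continuous
  rw [dist_eq_norm, dist_eq_norm]
  refine ContinuousLinearMap.opNorm_le_bound _ (by positivity) fun a => ?_
  have h1 := ((starL ℂ : A ≃L⋆[ℂ] A) : A →L⋆[ℂ] A).le_opNorm a
  have h2 := (μ - ν).le_opNorm (star a)
  have h3 : ‖(starDual μ - starDual ν) a‖ = ‖(μ - ν) (star a)‖ := by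
    rw [sub_apply, sub_apply, starDual_apply,
      starDual_apply, ← map_sub, RCLike.norm_conj]
  rw [h3]
  calc _ ≤ _ := h2
    _ ≤ ‖μ - ν‖ * (‖((starL ℂ : A ≃L⋆[ℂ] A) : A →L⋆[ℂ] A)‖ * ‖a‖) := by
      gcongr
      exact h1
    _ = _ := by rw [coe_nnnorm]; ring

theorem continuous_star_weakStar_iff (P : Submodule ℂ (StrongDual ℂ A)) :
    Continuous[weakStarTopology (P : Set (StrongDual ℂ A)),
      weakStarTopology (P : Set (StrongDual ℂ A))] (fun a : A => star a) ↔
    ∀ μ ∈ P, starDual μ ∈ P := by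
  constructor
  · intro h μ hμ
    obtain ⟨ν, hν, e⟩ := exists_mem_eq_of_continuous_weakStar P (starDual μ).toLinearMap
      ((@Continuous.comp A ℂ ℂ (weakStarTopology (P : Set (StrongDual ℂ A))) _ _ _ _
        Complex.continuous_conj (continuous_weakStar_iff.1 h μ hμ)))
    have : starDual μ = ν := ContinuousLinearMap.ext e
    rwa [this]
  · intro h
    rw [continuous_weakStar_iff]
    intro μ hμ
    have h1 := @Continuous.comp A ℂ ℂ (weakStarTopology (P : Set (StrongDual ℂ A))) _ _ _ _
        Complex.continuous_conj (continuous_weakStar_apply (h μ hμ))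
    convert! h1 using 1
    ext a
    simp

end StarDual

section Converse

variable {A : Type u} [NonUnitalNormedRing A] [NormedSpace ℂ A] [IsScalarTower ℂ A A]
  [SMulCommClass ℂ A A] [StarRing A] [StarModule ℂ A] [ContinuousStar A]

theorem continuous_star_weakStar_of_representation {P : Submodule ℂ (StrongDual ℂ A)}
    (hP : IsDualBanachAlgebra P) {E : Type u} [NormedAddCommGroup E] [NormedSpace ℂ E]
    [StarRing (E →L[ℂ] E)] [StarModule ℂ (E →L[ℂ] E)] [ContinuousStar (E →L[ℂ] E)]
    (π : A →⋆ₙₐ[ℂ] (E →L[ℂ] E)) (hinj : Function.Injective π)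
    (hπ : Continuous[weakStarTopology (P : Set (StrongDual ℂ A)),
      weakStarTopology (operatorPredual E)] (fun a : A => π a)) :
    Continuous[weakStarTopology (P : Set (StrongDual ℂ A)),
      weakStarTopology (P : Set (StrongDual ℂ A))] (fun a : A => star a) := by
  rw [continuous_star_weakStar_iff]
  have hcoef : ∀ (l : StrongDual ℂ E) (x : E), ∃ μ ∈ P, ∀ a, l (π a x) = μ a := by
    intro l x
    let φ : A →ₗ[ℂ] ℂ :=
      { toFun := fun a => l (π a x)
        map_add' := fun a b => by simp
        map_smul' := fun c a => by simp }
    exact exists_mem_eq_of_continuous_weakStar P φ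
      (continuous_weakStar_iff.1 hπ _ (rankOne_mem_operatorPredual l x))
  -- The part of `P` that `starDual` keeps inside `P` is closed; it remains to see that it is dense.
  -- A functional on `P` vanishing there is evaluation at some `a`, and `a` kills every coefficient
  -- of `π`.
  let M : Submodule ℂ P :=
    { carrier := {μ | starDual (μ : StrongDual ℂ A) ∈ P}
      add_mem' := fun {μ ν} hμ hν => by
        have : starDual ((μ + ν : P) : StrongDual ℂ A) = starDual μ + starDual ν := by
          ext; simp
        simpa only [Set.mem_ofPred_eq, this] using P.add_mem hμ hν
      zero_mem' := by
        have : starDual ((0 : P) : StrongDual ℂ A) = 0 := by ext; simp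
        simp only [Set.mem_ofPred_eq, this, P.zero_mem]
      smul_mem' := fun c μ hμ => by
        have : starDual ((c • μ : P) : StrongDual ℂ A) = conj c • starDual μ := by
          ext; simp
        simpa only [Set.mem_ofPred_eq, this] using P.smul_mem _ hμ }
  have hM : IsClosed (M : Set P) :=
    hP.isClosed.preimage (continuous_starDual.comp continuous_subtype_val)
  have htop : M = ⊤ := by
    refine eq_top_of_isClosed_of_dual (X := P) M hM fun F hF => ?_
    obtain ⟨a, rfl⟩ := hP.bijective.2 F
    suffices h : π a = 0 by
      have : a = 0 := hinj (by rw [h, map_zero])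
      rw [this]
      ext μ
      simp [toDualOfSubspace]
    ext x
    refine SeparatingDual.eq_zero_of_forall_dual_eq_zero (R := ℂ) fun l => ?_
    obtain ⟨μ, hμ, e⟩ := hcoef l x
    rw [e]
    refine hF ⟨μ, hμ⟩ ?_
    obtain ⟨k, y, hk⟩ := exists_conj_apply_star l x
    obtain ⟨ν, hν, e'⟩ := hcoef k y
    have : starDual μ = ν := by
      ext b
      rw [starDual_apply, ← e, ← e', ← hk, map_star]
    change starDual μ ∈ P
    rwa [this]
  intro μ hμ
  have : (⟨μ, hμ⟩ : P) ∈ M := htop ▸ Submodule.mem_top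
  exact this

end Converse

/-! ### Hermitian forms and the involutions they define -/

section FormInvolution

variable {E : Type u} [NormedAddCommGroup E] [NormedSpace ℂ E]

/-- The adjoint of `T` for the sesquilinear form `[x, y] = J y x`. -/
noncomputable def formAdjoint (J : E ≃L⋆[ℂ] StrongDual ℂ E) (T : E →L[ℂ] E) : E →L[ℂ] E :=
  (J.symm : StrongDual ℂ E →L⋆[ℂ] E).comp
    (((ContinuousLinearMap.compL ℂ E E ℂ).flip T).comp (J : E →L⋆[ℂ] StrongDual ℂ E))

theorem formAdjoint_apply (J : E ≃L⋆[ℂ] StrongDual ℂ E) (T : E →L[ℂ] E) (x z : E) :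
    J (formAdjoint J T x) z = J x (T z) := by
  simp [formAdjoint]

theorem formAdjoint_eq {J : E ≃L⋆[ℂ] StrongDual ℂ E} {T S : E →L[ℂ] E}
    (h : ∀ x z, J (S x) z = J x (T z)) : formAdjoint J T = S := by
  refine ContinuousLinearMap.ext fun x => J.injective (ContinuousLinearMap.ext fun z => ?_)
  rw [formAdjoint_apply, h]

/-- A Hermitian form inducing an isomorphism `J : E → E'` defines an involution of `B(E)`. -/
theorem exists_involution_of_form (J : E ≃L⋆[ℂ] StrongDual ℂ E)
    (hJ : ∀ x y, J y x = conj (J x y)) :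
    ∃ (_ : StarRing (E →L[ℂ] E)) (_ : StarModule ℂ (E →L[ℂ] E))
      (_ : ContinuousStar (E →L[ℂ] E)), ∀ T : E →L[ℂ] E, star T = formAdjoint J T := by
  have hadd : ∀ S T : E →L[ℂ] E, formAdjoint J (S + T) = formAdjoint J S + formAdjoint J T :=
    fun S T => formAdjoint_eq fun x z => by simp [formAdjoint_apply]
  let s : StarRing (E →L[ℂ] E) :=
    { star := formAdjoint J
      -- Hermitian symmetry is what makes the double adjoint return `T`.
      star_involutive := fun T => formAdjoint_eq fun x z => by
        rw [hJ, ← formAdjoint_apply, ← hJ]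
      star_mul := fun S T => formAdjoint_eq fun x z => by
        simp [formAdjoint_apply]
      star_add := hadd }
  refine ⟨s, ⟨fun c T => formAdjoint_eq fun x z => ?_⟩, ⟨?_⟩, fun T => rfl⟩
  · change J (star c • formAdjoint J T x) z = _
    simp [formAdjoint_apply]
  · let f : (E →L[ℂ] E) →+ (E →L[ℂ] E) :=
      { toFun := formAdjoint J
        map_zero' := formAdjoint_eq fun x z => by simp
        map_add' := hadd }
    refine AddMonoidHomClass.continuous_of_bound f
      (‖(J.symm : StrongDual ℂ E →L⋆[ℂ] E)‖ * ‖(J : E →L⋆[ℂ] StrongDual ℂ E)‖) fun T => ?_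
    refine ContinuousLinearMap.opNorm_le_bound _ (by positivity) fun x => ?_
    calc ‖(J.symm : StrongDual ℂ E →L⋆[ℂ] E) ((J x).comp T)‖
        ≤ ‖(J.symm : StrongDual ℂ E →L⋆[ℂ] E)‖ * ‖(J x).comp T‖ :=
          ContinuousLinearMap.le_opNorm _ _
      _ ≤ ‖(J.symm : StrongDual ℂ E →L⋆[ℂ] E)‖ *
          ((‖(J : E →L⋆[ℂ] StrongDual ℂ E)‖ * ‖x‖) * ‖T‖) := by
          gcongr
          refine (ContinuousLinearMap.opNorm_comp_le _ _).trans ?_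
          gcongr
          exact (J : E →L⋆[ℂ] StrongDual ℂ E).le_opNorm x
      _ = _ := by ring

end FormInvolution

/-- A bijective bounded conjugate-linear map of Banach spaces is an isomorphism. -/
noncomputable def antilinearEquivOfBijective {X Y : Type u} [NormedAddCommGroup X]
    [NormedSpace ℂ X] [CompleteSpace X] [NormedAddCommGroup Y] [NormedSpace ℂ Y] [CompleteSpace Y]
    (f : X →L⋆[ℂ] Y) (hf : Function.Bijective f) : X ≃L⋆[ℂ] Y :=
  ContinuousLinearEquiv.ofBijective (σ := starRingEnd ℂ) (σ' := starRingEnd ℂ) (E := X) (F := Y) f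
    (LinearMap.ker_eq_bot.2 hf.1) (LinearMap.range_eq_top.2 hf.2)

/-! ### Permanence of reflexivity, and the form on `F × D` -/

section ReflexivityPermanence

variable {F G : Type u} [NormedAddCommGroup F] [NormedSpace ℂ F] [NormedAddCommGroup G]
  [NormedSpace ℂ G]

theorem isReflexiveSpace_dual (hF : IsReflexiveSpace F) : IsReflexiveSpace (StrongDual ℂ F) := by
  intro Φ
  refine ⟨Φ.comp (NormedSpace.inclusionInDoubleDual ℂ F), ContinuousLinearMap.ext fun g => ?_⟩
  obtain ⟨x, rfl⟩ := hF g
  rfl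

theorem isReflexiveSpace_of_antilinearEquiv (c : F ≃L⋆[ℂ] G) (hG : IsReflexiveSpace G) :
    IsReflexiveSpace F := by
  let K : ℂ →L⋆[ℂ] ℂ := ((starL ℂ : ℂ ≃L⋆[ℂ] ℂ) : ℂ →L⋆[ℂ] ℂ)
  let c' : F →L⋆[ℂ] G := c
  let t : StrongDual ℂ G → StrongDual ℂ F := fun g => K.comp (g.comp c')
  have ht : ∀ g x, t g x = conj (g (c x)) := fun g x => rfl
  intro Φ
  let Ψ : StrongDual ℂ (StrongDual ℂ G) := LinearMap.mkContinuous
    { toFun := fun g => conj (Φ (t g))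
      map_add' := fun g h => by
        have : t (g + h) = t g + t h := by ext; simp [ht]
        simp [this]
      map_smul' := fun k g => by
        have : t (k • g) = conj k • t g := by ext; simp [ht]
        simp [this] } (‖Φ‖ * ‖c'‖) fun g => by
      change ‖conj (Φ (t g))‖ ≤ _
      rw [RCLike.norm_conj, mul_assoc]
      refine (Φ.le_opNorm _).trans ?_
      gcongr
      refine ContinuousLinearMap.opNorm_le_bound _ (by positivity) fun x => ?_
      rw [ht, RCLike.norm_conj]
      calc ‖g (c' x)‖ ≤ ‖g‖ * (‖c'‖ * ‖x‖) := g.le_opNorm_of_le (c'.le_opNorm x)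
        _ = _ := by ring
  obtain ⟨y, hy⟩ := hG Ψ
  refine ⟨c.symm y, ContinuousLinearMap.ext fun h => ?_⟩
  let g : StrongDual ℂ G := K.comp (h.comp (c.symm : G →L⋆[ℂ] F))
  have hg : ∀ z, g z = conj (h (c.symm z)) := fun z => rfl
  have h1 : g y = conj (Φ (t g)) := DFunLike.congr_fun hy g
  have h2 : t g = h := by ext x; simp [ht, hg]
  rw [h2, hg] at h1
  exact (starRingEnd ℂ).injective h1

theorem isReflexiveSpace_prod (hF : IsReflexiveSpace F) (hG : IsReflexiveSpace G) :
    IsReflexiveSpace (F × G) := by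
  intro Φ
  obtain ⟨x, hx⟩ := hF (Φ.comp ((ContinuousLinearMap.compL ℂ (F × G) F ℂ).flip
    (ContinuousLinearMap.fst ℂ F G)))
  obtain ⟨y, hy⟩ := hG (Φ.comp ((ContinuousLinearMap.compL ℂ (F × G) G ℂ).flip
    (ContinuousLinearMap.snd ℂ F G)))
  refine ⟨(x, y), ContinuousLinearMap.ext fun l => ?_⟩
  have h1 := DFunLike.congr_fun hx (l.comp (ContinuousLinearMap.inl ℂ F G))
  have h2 := DFunLike.congr_fun hy (l.comp (ContinuousLinearMap.inr ℂ F G))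
  simp only [NormedSpace.dual_def, ContinuousLinearMap.comp_apply,
    ContinuousLinearMap.flip_apply, ContinuousLinearMap.compL_apply,
    ContinuousLinearMap.inl_apply, ContinuousLinearMap.inr_apply] at h1 h2
  rw [NormedSpace.dual_def]
  have e1 : l (x, y) = l (x, 0) + l (0, y) := by rw [← map_add]; simp
  have e2 : l = (l.comp (ContinuousLinearMap.inl ℂ F G)).comp (ContinuousLinearMap.fst ℂ F G) +
      (l.comp (ContinuousLinearMap.inr ℂ F G)).comp (ContinuousLinearMap.snd ℂ F G) := by
    have e0 : l (0, 0) = 0 := map_zero l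
    ext <;> simp [e0]
  rw [e1, h1, h2, ← map_add, ← e2]

/-- Complex conjugation identifies the conjugate dual with the dual. -/
noncomputable def antidualEquiv : (F →L⋆[ℂ] ℂ) ≃L⋆[ℂ] StrongDual ℂ F :=
  let K : ℂ →L⋆[ℂ] ℂ := ((starL ℂ : ℂ ≃L⋆[ℂ] ℂ) : ℂ →L⋆[ℂ] ℂ)
  LinearEquiv.toContinuousLinearEquivOfBounds
    { toFun := fun d => K.comp d
      invFun := fun l => K.comp l
      map_add' := fun d e => by ext; simp
      map_smul' := fun k d => by ext; simp [K]
      left_inv := fun d => by ext; simp [K]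
      right_inv := fun l => by ext; simp [K] } 1 1
    (fun d => by
      rw [one_mul]
      refine ContinuousLinearMap.opNorm_le_bound _ (norm_nonneg _) fun x => ?_
      change ‖conj (d x)‖ ≤ _
      rw [RCLike.norm_conj]
      exact d.le_opNorm x)
    (fun l => by
      rw [one_mul]
      refine ContinuousLinearMap.opNorm_le_bound _ (norm_nonneg _) fun x => ?_
      change ‖conj (l x)‖ ≤ _
      rw [RCLike.norm_conj]
      exact l.le_opNorm x)

end ReflexivityPermanence

section Double

variable {F D : Type u} [NormedAddCommGroup F] [NormedSpace ℂ F] [NormedAddCommGroup D]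
  [NormedSpace ℂ D]

/-- For a conjugate-linear isomorphism `c : D → F'`, the Hermitian form
`[(x, e), (y, d)] = c d x + conj (c e y)` on `F × D`. -/
noncomputable def doubleForm (c : D ≃L⋆[ℂ] StrongDual ℂ F) : (F × D) →L⋆[ℂ] StrongDual ℂ (F × D) :=
  LinearMap.mkContinuous₂
    (LinearMap.mk₂'ₛₗ (starRingEnd ℂ) (RingHom.id ℂ)
      (fun (v w : F × D) => c v.2 w.1 + conj (c w.2 v.1))
      (fun v v' w => by simp; ring) (fun k v w => by simp; ring)
      (fun v w w' => by simp; ring) (fun k v w => by simp; ring))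
    (2 * ‖(c : D →L⋆[ℂ] StrongDual ℂ F)‖) (fun v w => by
        change ‖c v.2 w.1 + conj (c w.2 v.1)‖ ≤ _
        have key : ∀ v w : F × D,
            ‖c v.2 w.1‖ ≤ ‖(c : D →L⋆[ℂ] StrongDual ℂ F)‖ * ‖v‖ * ‖w‖ := fun v w => by
          refine ((c v.2).le_of_opNorm_le
            ((c : D →L⋆[ℂ] StrongDual ℂ F).le_opNorm v.2) w.1).trans ?_
          gcongr
          exacts [norm_snd_le v, norm_fst_le w]
        have h5 := norm_add_le (c v.2 w.1) (conj (c w.2 v.1))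
        rw [RCLike.norm_conj] at h5
        linarith [key v w, key w v])

@[simp]
theorem doubleForm_apply (c : D ≃L⋆[ℂ] StrongDual ℂ F) (v w : F × D) :
    doubleForm c v w = c v.2 w.1 + conj (c w.2 v.1) := rfl

theorem doubleForm_bijective (c : D ≃L⋆[ℂ] StrongDual ℂ F) (hF : IsReflexiveSpace F) :
    Function.Bijective (doubleForm c) := by
  constructor
  · rw [injective_iff_map_eq_zero]
    rintro ⟨y, d⟩ h
    have h1 : d = 0 := by
      rw [← c.map_eq_zero_iff]
      ext x
      simpa using DFunLike.congr_fun h (x, 0)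
    have h2 : y = 0 := SeparatingDual.eq_zero_of_forall_dual_eq_zero (R := ℂ) fun l => by
      simpa using DFunLike.congr_fun h (0, c.symm l)
    rw [h1, h2]; rfl
  · intro g
    let K : ℂ →L⋆[ℂ] ℂ := ((starL ℂ : ℂ ≃L⋆[ℂ] ℂ) : ℂ →L⋆[ℂ] ℂ)
    -- Transported by `c`, the restriction of `g` to `D` becomes an element of `F''`, and
    -- reflexivity represents it by a vector of `F`.
    obtain ⟨y, hy⟩ := hF (K.comp ((g.comp (ContinuousLinearMap.inr ℂ F D)).comp
      (c.symm : StrongDual ℂ F →L⋆[ℂ] D)))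
    have hy' : ∀ l : StrongDual ℂ F, l y = conj (g (0, c.symm l)) := DFunLike.congr_fun hy
    refine ⟨(y, c.symm (g.comp (ContinuousLinearMap.inl ℂ F D))), ?_⟩
    refine ContinuousLinearMap.ext fun w => ?_
    rw [doubleForm_apply, hy', Complex.conj_conj]
    simp only [ContinuousLinearEquiv.apply_symm_apply, ContinuousLinearEquiv.symm_apply_apply,
      ContinuousLinearMap.comp_apply, ContinuousLinearMap.inl_apply]
    rw [← map_add]
    simp

end Double

/-! ### Making a representation involutive -/

section Representation

variable {A : Type u} [NonUnitalNormedRing A] [NormedSpace ℂ A]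

/-- A bounded representation whose coefficient functionals lie in a closed subspace `P` is
weak-star continuous. -/
theorem continuous_weakStar_of_coefficients [CompleteSpace A] {P : Submodule ℂ (StrongDual ℂ A)}
    (hP : IsClosed (P : Set (StrongDual ℂ A))) {E : Type u} [NormedAddCommGroup E]
    [NormedSpace ℂ E] (ρ : A →L[ℂ] E →L[ℂ] E)
    (hρ : ∀ (l : StrongDual ℂ E) (x : E), ∃ μ ∈ P, ∀ a, l (ρ a x) = μ a) :
    Continuous[weakStarTopology (P : Set (StrongDual ℂ A)),
      weakStarTopology (operatorPredual E)] (fun a : A => ρ a) := by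
  rw [continuous_weakStar_iff]
  rintro φ ⟨l, x, hs, hφ⟩
  choose μ hμ e using hρ
  have hnorm : ∀ n, ‖μ (l n) (x n)‖ ≤ ‖ρ‖ * (‖l n‖ * ‖x n‖) := by
    intro n
    refine ContinuousLinearMap.opNorm_le_bound _ (by positivity) fun a => ?_
    rw [← e]
    calc _ ≤ ‖l n‖ * ‖ρ a (x n)‖ := (l n).le_opNorm _
      _ ≤ ‖l n‖ * ((‖ρ‖ * ‖a‖) * ‖x n‖) := by
        gcongr
        exact (ρ a).le_of_opNorm_le (ρ.le_opNorm a) _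
      _ = _ := by ring
  have hsum : Summable fun n => μ (l n) (x n) :=
    Summable.of_norm_bounded (hs.mul_left ‖ρ‖) hnorm
  -- The series of coefficient functionals converges in norm, so its sum stays in the closed
  -- subspace `P`.
  have hmem : ∑' n, μ (l n) (x n) ∈ P :=
    hP.mem_of_tendsto hsum.hasSum
      (Filter.Eventually.of_forall fun s => P.sum_mem fun n _ => hμ _ _)
  convert! continuous_weakStar_apply hmem using 1
  ext a
  have h1 := hsum.hasSum.mapL (ContinuousLinearMap.apply ℂ ℂ a)
  refine (hφ (ρ a)).unique ?_
  simp only [e]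
  exact h1

variable [StarRing A] [StarModule ℂ A] [ContinuousStar A]

theorem exists_involutive_representation [CompleteSpace A] {P : Submodule ℂ (StrongDual ℂ A)}
    (hP : IsClosed (P : Set (StrongDual ℂ A))) (hstar : ∀ μ ∈ P, starDual μ ∈ P)
    {F D : Type u} [NormedAddCommGroup F] [NormedSpace ℂ F] [CompleteSpace F]
    [NormedAddCommGroup D] [NormedSpace ℂ D] [CompleteSpace D] (c : D ≃L⋆[ℂ] StrongDual ℂ F)
    (hF : IsReflexiveSpace F) (ρ : A →L[ℂ] F →L[ℂ] F) (hmul : ∀ a b, ρ (a * b) = ρ a * ρ b)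
    {r : ℝ} (hr : 0 < r) (hbelow : ∀ a, r * ‖a‖ ≤ ‖ρ a‖)
    (hρ : ∀ (l : StrongDual ℂ F) (x : F), ∃ μ ∈ P, ∀ a, l (ρ a x) = μ a) :
    ∃ (E : Type u) (_ : NormedAddCommGroup E) (_ : NormedSpace ℂ E) (_ : CompleteSpace E)
      (_ : StarRing (E →L[ℂ] E)) (_ : StarModule ℂ (E →L[ℂ] E))
      (_ : ContinuousStar (E →L[ℂ] E)) (π : A →⋆ₙₐ[ℂ] (E →L[ℂ] E))
      (J : E →L⋆[ℂ] StrongDual ℂ E),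
      IsReflexiveSpace E ∧
      IsHomeomorph (fun y : E => J y) ∧
      (∀ (T : E →L[ℂ] E) (x y : E), J y ((star T) x) = J (T y) x) ∧
      Topology.IsClosedEmbedding (fun a : A => π a) ∧
      Continuous[weakStarTopology (P : Set (StrongDual ℂ A)),
        weakStarTopology (operatorPredual E)] (fun a : A => π a) := by
  let J : (F × D) ≃L⋆[ℂ] StrongDual ℂ (F × D) :=
    antilinearEquivOfBijective (doubleForm c) (doubleForm_bijective c hF)
  have hJapp : ∀ v w : F × D, J v w = c v.2 w.1 + conj (c w.2 v.1) := fun v w => rfl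
  have hJ : ∀ x y, J y x = conj (J x y) := fun x y => by
    simp only [hJapp, map_add, Complex.conj_conj]
    ring
  obtain ⟨s1, s2, s3, hs⟩ := exists_involution_of_form J hJ
  let S : A →L⋆[ℂ] A := ((starL ℂ : A ≃L⋆[ℂ] A) : A →L⋆[ℂ] A)
  have hS : ∀ a, ‖star a‖ ≤ ‖S‖ * ‖a‖ := S.le_opNorm
  let c1 : D →L⋆[ℂ] StrongDual ℂ F := c
  let c2 : StrongDual ℂ F →L⋆[ℂ] D := c.symm
  let δ : (F →L[ℂ] F) → D →L[ℂ] D := fun T =>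
    c2.comp (((ContinuousLinearMap.compL ℂ F F ℂ).flip T).comp c1)
  have hδ : ∀ T d, δ T d = c.symm ((c d).comp T) := fun T d => rfl
  have hcδ : ∀ T d x, c (δ T d) x = c d (T x) := fun T d x => by
    rw [hδ, ContinuousLinearEquiv.apply_symm_apply]; rfl
  -- `δ` is conjugate-linear and reverses products; composing with `star` repairs both.
  let σ : A → (F × D) →L[ℂ] (F × D) := fun a => (ρ a).prodMap (δ (ρ (star a)))
  have hσ : ∀ a (v : F × D), σ a v = (ρ a v.1, δ (ρ (star a)) v.2) := fun a v => rfl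
  let τ : A →L[ℂ] (F × D) →L[ℂ] (F × D) := LinearMap.mkContinuous
    { toFun := σ
      map_add' := fun a b => by
        refine ContinuousLinearMap.ext fun v => ?_
        rw [add_apply, hσ, hσ, hσ, Prod.mk_add_mk, hδ, hδ, hδ, ← map_add]
        simp
      map_smul' := fun k a => by
        refine ContinuousLinearMap.ext fun v => ?_
        rw [smul_apply, hσ, hσ, Prod.smul_mk, hδ, hδ]
        simp [star_smul] } (‖ρ‖ + ‖c2‖ * ‖c1‖ * ‖ρ‖ * ‖S‖) fun a => by
      refine ContinuousLinearMap.opNorm_le_bound _ (by positivity) fun v => ?_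
      change ‖((ρ a v.1, c2 ((c1 v.2).comp (ρ (star a)))) : F × D)‖ ≤ _
      have h1 : ‖ρ a v.1‖ ≤ ‖ρ‖ * ‖a‖ * ‖v‖ := by
        refine ((ρ a).le_of_opNorm_le (ρ.le_opNorm a) _).trans ?_
        gcongr
        exact norm_fst_le v
      have h2 : ‖c2 ((c1 v.2).comp (ρ (star a)))‖ ≤
          ‖c2‖ * ((‖c1‖ * ‖v‖) * (‖ρ‖ * (‖S‖ * ‖a‖))) := by
        refine c2.le_opNorm_of_le ((ContinuousLinearMap.opNorm_comp_le _ _).trans ?_)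
        gcongr
        · exact c1.le_opNorm_of_le (norm_snd_le v)
        · exact ρ.le_opNorm_of_le (hS a)
      refine (norm_prod_le_iff (r := _)).2 ⟨?_, ?_⟩
      · have : 0 ≤ ‖c2‖ * ‖c1‖ * ‖ρ‖ * ‖S‖ * ‖a‖ * ‖v‖ := by positivity
        linarith
      · have : 0 ≤ ‖ρ‖ * ‖a‖ * ‖v‖ := by positivity
        linarith
  have hτ : ∀ a (v : F × D), τ a v = (ρ a v.1, δ (ρ (star a)) v.2) := fun a v => rfl
  let π : A →⋆ₙₐ[ℂ] ((F × D) →L[ℂ] (F × D)) :=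
    { toFun := τ
      map_smul' := fun k a => map_smul τ k a
      map_zero' := map_zero τ
      map_add' := map_add τ
      map_mul' := fun a b => by
        refine ContinuousLinearMap.ext fun v => ?_
        rw [mul_apply_eq_comp, hτ, hτ, hτ, star_mul, hmul, hmul, hδ, hδ (ρ (star a)), hδ,
          ContinuousLinearEquiv.apply_symm_apply]
        rfl
      map_star' := fun a => by
        rw [hs]
        refine (formAdjoint_eq fun x z => ?_).symm
        simp only [hJapp, hτ, hcδ, star_star] }
  have hbelow' : ∀ a, r * ‖a‖ ≤ ‖τ a‖ := by
    intro a
    refine (hbelow a).trans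
      (ContinuousLinearMap.opNorm_le_bound _ (τ a).opNorm_nonneg fun x => ?_)
    have h1 := (τ a).le_opNorm (x, 0)
    have h2 : ‖((x, 0) : F × D)‖ = ‖x‖ := by simp [Prod.norm_def]
    rw [h2] at h1
    exact (norm_fst_le (τ a (x, 0))).trans h1
  refine ⟨F × D, inferInstance, inferInstance, inferInstance, s1, s2, s3, π, J,
    isReflexiveSpace_prod hF (isReflexiveSpace_of_antilinearEquiv c (isReflexiveSpace_dual hF)),
    J.toHomeomorph.isHomeomorph, ?_, ?_, ?_⟩
  · intro T x y
    change J y (star T x) = J (T y) x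
    rw [hs, hJ, formAdjoint_apply, ← hJ]
  · have hanti : AntilipschitzWith (Real.toNNReal r⁻¹) τ :=
      AddMonoidHomClass.antilipschitz_of_bound τ fun a => by
        rw [Real.coe_toNNReal _ (by positivity), inv_mul_eq_div, le_div_iff₀ hr, mul_comm]
        exact hbelow' a
    exact hanti.isClosedEmbedding τ.uniformContinuous
  · refine continuous_weakStar_of_coefficients hP τ fun l v => ?_
    obtain ⟨w, rfl⟩ := J.surjective l
    obtain ⟨μ, hμ, e⟩ := hρ (c w.2) v.1
    obtain ⟨ν, hν, e'⟩ := hρ (c v.2) w.1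
    refine ⟨μ + starDual ν, P.add_mem hμ (hstar ν hν), fun a => ?_⟩
    rw [hJapp, hτ, add_apply, starDual_apply, ← e, ← e', hcδ]

end Representation

/-! ### The interpolation space -/

section Slot

variable {W : Type u} [NormedAddCommGroup W] [NormedSpace ℂ W]

/-- The map `(f, y) ↦ 2ⁿ T f + 2⁻ⁿ y`. -/
noncomputable def slotSum (T : StrongDual ℂ W →L[ℂ] W) (n : ℕ) :
    (StrongDual ℂ W × W) →L[ℂ] W :=
  ((2 : ℂ) ^ n • T).coprod (((2 : ℂ) ^ n)⁻¹ • ContinuousLinearMap.id ℂ W)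

theorem slotSum_apply (T : StrongDual ℂ W →L[ℂ] W) (n : ℕ) (v : StrongDual ℂ W × W) :
    slotSum T n v = (2 : ℂ) ^ n • T v.1 + ((2 : ℂ) ^ n)⁻¹ • v.2 := by
  simp [slotSum]

/-- The space `W` with the quotient norm of `slotSum T n`, whose unit ball is essentially
`2ⁿ T(ball) + 2⁻ⁿ ball`. -/
def Slot (T : StrongDual ℂ W →L[ℂ] W) (n : ℕ) : Type u :=
  (StrongDual ℂ W × W) ⧸ (slotSum T n).ker

variable (T : StrongDual ℂ W →L[ℂ] W) (n : ℕ)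

noncomputable instance : NormedAddCommGroup (Slot T n) :=
  haveI : IsClosed ((slotSum T n).ker : Set (StrongDual ℂ W × W)) := (slotSum T n).isClosed_ker
  inferInstanceAs (NormedAddCommGroup ((StrongDual ℂ W × W) ⧸ (slotSum T n).ker))

noncomputable instance : NormedSpace ℂ (Slot T n) :=
  haveI : IsClosed ((slotSum T n).ker : Set (StrongDual ℂ W × W)) := (slotSum T n).isClosed_ker
  inferInstanceAs (NormedSpace ℂ ((StrongDual ℂ W × W) ⧸ (slotSum T n).ker))

instance [CompleteSpace W] : CompleteSpace (Slot T n) :=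
  inferInstanceAs (CompleteSpace ((StrongDual ℂ W × W) ⧸ (slotSum T n).ker))

/-- The quotient map. -/
noncomputable def slotMk : (StrongDual ℂ W × W) →L[ℂ] Slot T n :=
  (slotSum T n).ker.mkQL

/-- The underlying element of `W`. -/
noncomputable def slotVal : Slot T n →L[ℂ] W :=
  (slotSum T n).ker.liftQL (slotSum T n) le_rfl

@[simp]
theorem slotVal_slotMk (v : StrongDual ℂ W × W) :
    slotVal T n (slotMk T n v) = (2 : ℂ) ^ n • T v.1 + ((2 : ℂ) ^ n)⁻¹ • v.2 := by
  rw [← slotSum_apply]; rfl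

theorem norm_slotMk_le (v : StrongDual ℂ W × W) : ‖slotMk T n v‖ ≤ ‖v‖ :=
  Submodule.Quotient.norm_mk_le (S := (slotSum T n).ker) v

theorem exists_slotMk_eq (z : Slot T n) : ∃ v, slotMk T n v = z ∧ ‖v‖ ≤ 2 * ‖z‖ := by
  by_cases hz : z = 0
  · exact ⟨0, by simp [hz], by simp⟩
  · obtain ⟨v, hv, hlt⟩ := Submodule.Quotient.norm_mk_lt (S := (slotSum T n).ker) z
      (norm_pos_iff.2 hz)
    exact ⟨v, hv, by rw [two_mul]; exact hlt.le⟩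

theorem slotVal_injective : Function.Injective (slotVal T n) := by
  rw [injective_iff_map_eq_zero]
  intro z hz
  obtain ⟨v, rfl, -⟩ := exists_slotMk_eq T n z
  rw [slotVal_slotMk, ← slotSum_apply] at hz
  exact (Submodule.Quotient.mk_eq_zero (slotSum T n).ker).2 hz

/-- The inverse of `slotVal`. -/
noncomputable def slotSec : W →L[ℂ] Slot T n :=
  (slotMk T n).comp ((ContinuousLinearMap.inr ℂ _ _).comp
    ((2 : ℂ) ^ n • ContinuousLinearMap.id ℂ W))

@[simp]
theorem slotVal_slotSec (w : W) : slotVal T n (slotSec T n w) = w := by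
  simp [slotSec]

@[simp]
theorem slotSec_slotVal (z : Slot T n) : slotSec T n (slotVal T n z) = z :=
  slotVal_injective T n (by simp)

theorem norm_slotVal_zero_le (z : Slot T 0) : ‖slotVal T 0 z‖ ≤ 2 * (‖T‖ + 1) * ‖z‖ := by
  obtain ⟨v, rfl, hv⟩ := exists_slotMk_eq T 0 z
  rw [slotVal_slotMk]
  simp only [pow_zero, one_smul, inv_one]
  have h1 : ‖T v.1‖ ≤ ‖T‖ * ‖v‖ := T.le_opNorm_of_le (norm_fst_le v)
  have h2 := norm_add_le (T v.1) v.2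
  have h3 := norm_snd_le v
  have h4 : (‖T‖ + 1) * ‖v‖ ≤ (‖T‖ + 1) * (2 * ‖slotMk T 0 v‖) := by gcongr
  linarith

/-- The intertwining relation lifts `L` to `(f, y) ↦ (f ∘ R, L y)` on pairs. The bound does not
depend on `n`; its factor 2 comes from choosing a nearly optimal representative in the quotient. -/
theorem norm_slotSec_le {R L : W →L[ℂ] W} (h : ∀ f : StrongDual ℂ W, T (f.comp R) = L (T f))
    {C : ℝ} (hR : ‖R‖ ≤ C) (hL : ‖L‖ ≤ C) (z : Slot T n) :
    ‖slotSec T n (L (slotVal T n z))‖ ≤ 2 * C * ‖z‖ := by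
  obtain ⟨v, rfl, hv⟩ := exists_slotMk_eq T n z
  have e : slotSec T n (L (slotVal T n (slotMk T n v))) = slotMk T n (v.1.comp R, L v.2) := by
    apply slotVal_injective
    simp [h]
  have hC : 0 ≤ C := (norm_nonneg _).trans hR
  rw [e]
  refine (norm_slotMk_le T n _).trans ?_
  have h1 : ‖v.1.comp R‖ ≤ ‖v‖ * C :=
    (ContinuousLinearMap.opNorm_comp_le _ _).trans (by gcongr; exact norm_fst_le v)
  have h2 : ‖L v.2‖ ≤ C * ‖v‖ := (L.le_of_opNorm_le hL _).trans (by gcongr; exact norm_snd_le v)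
  have h3 : ‖v‖ * C ≤ (2 * ‖slotMk T n v‖) * C := by gcongr
  refine (norm_prod_le_iff (r := _)).2 ⟨by linarith, by linarith⟩

end Slot

section Interpolation

variable {W : Type u} [NormedAddCommGroup W] [NormedSpace ℂ W] {I : Type u}

/-- The `ℓ²`-sum of the renormed copies of `W`. -/
abbrev SlotSpace (T : I → StrongDual ℂ W →L[ℂ] W) : Type u :=
  lp (fun p : I × ℕ => Slot (T p.1) p.2) 2

/-- The Davis-Figiel-Johnson-Pełczyński interpolation space of a family of operators. -/
noncomputable def interpolation (T : I → StrongDual ℂ W →L[ℂ] W) :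
    Submodule ℂ (SlotSpace T) where
  carrier := {z | ∀ (i : I) (n : ℕ), slotVal (T i) n (z (i, n)) = slotVal (T i) 0 (z (i, 0))}
  add_mem' {z w} hz hw i n := by
    simp only [lp.coeFn_add, Pi.add_apply, map_add]
    rw [hz, hw]
  zero_mem' i n := by simp
  smul_mem' c z hz i n := by
    simp only [lp.coeFn_smul, Pi.smul_apply, map_smul]
    rw [hz]

variable (T : I → StrongDual ℂ W →L[ℂ] W)

theorem isClosed_interpolation : IsClosed (interpolation T : Set (SlotSpace T)) := by
  have : (interpolation T : Set (SlotSpace T)) = ⋂ (i : I) (n : ℕ),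
      {z | slotVal (T i) n (lp.evalCLM ℂ (fun p : I × ℕ => Slot (T p.1) p.2) 2 (i, n) z) =
        slotVal (T i) 0 (lp.evalCLM ℂ (fun p : I × ℕ => Slot (T p.1) p.2) 2 (i, 0) z)} := by
    ext z
    simp only [Set.mem_iInter]
    rfl
  rw [this]
  exact isClosed_iInter fun i => isClosed_iInter fun n =>
    isClosed_eq (by fun_prop) (by fun_prop)

instance [CompleteSpace W] : CompleteSpace (interpolation T) :=
  (isClosed_interpolation T).completeSpace_coe

/-- The coordinate maps of the interpolation space. -/
noncomputable def interpolationCoord (i : I) : interpolation T →L[ℂ] W :=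
  (slotVal (T i) 0).comp ((lp.evalCLM ℂ (fun p : I × ℕ => Slot (T p.1) p.2) 2 (i, 0)).comp
    (interpolation T).subtypeL)

variable {T}

theorem slotVal_apply_eq_coord (z : interpolation T) (i : I) (n : ℕ) :
    slotVal (T i) n ((z : SlotSpace T) (i, n)) = interpolationCoord T i z := z.2 i n

theorem interpolation_ext {z w : interpolation T}
    (h : ∀ i, interpolationCoord T i z = interpolationCoord T i w) : z = w := by
  refine Subtype.ext (lp.ext (funext fun p => slotVal_injective _ _ ?_))
  rw [slotVal_apply_eq_coord z p.1 p.2, slotVal_apply_eq_coord w p.1 p.2, h]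

theorem norm_interpolationCoord_le (i : I) (z : interpolation T) :
    ‖interpolationCoord T i z‖ ≤ 2 * (‖T i‖ + 1) * ‖z‖ := by
  refine (norm_slotVal_zero_le (T i) _).trans ?_
  gcongr
  exact lp.norm_apply_le_norm (by simp) (z : SlotSpace T) (i, 0)

theorem sum_norm_sq_le (z : SlotSpace T) (s : Finset (I × ℕ)) :
    ∑ p ∈ s, ‖z p‖ ^ 2 ≤ ‖z‖ ^ 2 := by
  have := lp.sum_rpow_le_norm_rpow (p := 2) (by simp) z s
  simpa using this

/-- Assembles an element of the interpolation space from its coordinates. -/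
theorem exists_interpolation_of_bound (w : I → W) (y : ∀ p : I × ℕ, Slot (T p.1) p.2)
    (hy : ∀ i n, slotVal (T i) n (y (i, n)) = w i) {C : ℝ} (hC : 0 ≤ C)
    (hs : ∀ s : Finset (I × ℕ), ∑ p ∈ s, ‖y p‖ ^ 2 ≤ C ^ 2) :
    ∃ z : interpolation T, (∀ i, interpolationCoord T i z = w i) ∧ ‖z‖ ≤ C := by
  have hmem : Memℓp y 2 := memℓp_gen' (C := C ^ 2) fun s => by simpa using hs s
  let z : SlotSpace T := ⟨y, hmem⟩
  refine ⟨⟨z, fun i n => (hy i n).trans (hy i 0).symm⟩, fun i => hy i 0, ?_⟩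
  refine lp.norm_le_of_forall_sum_le (p := 2) (by simp) hC fun s => ?_
  simpa using hs s

/-- The coordinate functionals span a dense subspace of the dual. -/
theorem closure_span_coord_eq_top : (Submodule.span ℂ {g : StrongDual ℂ (interpolation T) |
    ∃ (i : I) (h : StrongDual ℂ W), g = h.comp (interpolationCoord T i)}).topologicalClosure
      = ⊤ := by
  classical
  rw [eq_top_iff]
  intro g _
  obtain ⟨f, hf, -⟩ := exists_extension_norm_eq (interpolation T) g
  -- After a Hahn-Banach extension to the `ℓ²`-sum, the functional is a norm limit of finite sums,
  -- and each term factors through a coordinate because `slotVal` is invertible.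
  have h1 := (hasSum_dual_single f).mapL
    (ContinuousLinearMap.precomp ℂ (interpolation T).subtypeL)
  have h2 : (ContinuousLinearMap.precomp ℂ (interpolation T).subtypeL) f = g :=
    ContinuousLinearMap.ext hf
  rw [h2] at h1
  refine mem_closure_of_tendsto h1 (Filter.Eventually.of_forall fun s => ?_)
  refine Submodule.sum_mem _ fun p _ => Submodule.subset_span
    ⟨p.1, (f.comp (lp.singleContinuousLinearMap ℂ _ 2 p)).comp (slotSec (T p.1) p.2), ?_⟩
  refine ContinuousLinearMap.ext fun z => ?_
  simp only [ContinuousLinearMap.comp_apply]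
  rw [← slotVal_apply_eq_coord z p.1 p.2, slotSec_slotVal]
  rfl

end Interpolation

theorem exists_eq_of_forall_norm_sub_le {X Y : Type*} [NormedAddCommGroup X] [NormedSpace ℂ X]
    [CompleteSpace X] [NormedAddCommGroup Y] [NormedSpace ℂ Y] {κ : X →L[ℂ] Y}
    (hκ : ∀ x, ‖κ x‖ = ‖x‖) {y : Y} (h : ∀ ε > 0, ∃ x, ‖y - κ x‖ ≤ ε) : ∃ x, κ x = y := by
  have hcl : IsClosed (Set.range κ) :=
    (AddMonoidHomClass.isometry_of_norm κ hκ).isClosedEmbedding.isClosed_range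
  refine hcl.closure_subset (Metric.mem_closure_iff.2 fun ε hε => ?_)
  obtain ⟨x, hx⟩ := h (ε / 2) (half_pos hε)
  exact ⟨κ x, ⟨x, rfl⟩, by rw [dist_eq_norm]; linarith⟩

/-! ### Reflexivity of the interpolation space -/

section InterpolationReflexive

variable {W : Type u} [NormedAddCommGroup W] [NormedSpace ℂ W] {I : Type u}

/-- Sequences of approximate decompositions, with second components taken in the bidual. -/
abbrev DecompositionSpace (W : Type u) [NormedAddCommGroup W] [NormedSpace ℂ W] (I : Type u) :
    Type u :=
  I × ℕ → ℝ × WeakDual ℂ W × WeakDual ℂ (StrongDual ℂ W)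

/-- The value at `h` of the bidual element represented by the `n`-th decomposition. -/
noncomputable def decompositionVal (w : I → StrongDual ℂ W → W) (q : DecompositionSpace W I)
    (i : I) (n : ℕ) (h : StrongDual ℂ W) : ℂ :=
  (2 : ℂ) ^ n * (q (i, n)).2.1 (w i h) + ((2 : ℂ) ^ n)⁻¹ * (q (i, n)).2.2 h

theorem continuous_decompositionVal (w : I → StrongDual ℂ W → W) (i : I) (n : ℕ)
    (h : StrongDual ℂ W) : Continuous fun q => decompositionVal w q i n h := by
  unfold decompositionVal
  have h1 : Continuous fun q : DecompositionSpace W I => (q (i, n)).2.1 (w i h) :=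
    (WeakDual.eval_continuous _).comp (continuous_apply (i, n)).snd.fst
  have h2 : Continuous fun q : DecompositionSpace W I => (q (i, n)).2.2 h :=
    (WeakDual.eval_continuous _).comp (continuous_apply (i, n)).snd.snd
  exact (continuous_const.mul h1).add (continuous_const.mul h2)

/-- The decompositions representing elements of a ball of the interpolation space. -/
def decompositions (w : I → StrongDual ℂ W → W) : Set (DecompositionSpace W I) :=
  {q | (∀ s : Finset (I × ℕ), ∑ p ∈ s, (q p).1 ^ 2 ≤ 2 ^ 2) ∧ (∀ p, 0 ≤ (q p).1) ∧
    (∀ p x, ‖(q p).2.1 x‖ ≤ (q p).1 * ‖x‖) ∧ (∀ p f, ‖(q p).2.2 f‖ ≤ (q p).1 * ‖f‖) ∧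
    ∀ i n h, decompositionVal w q i n h = decompositionVal w q i 0 h}

/-- Tychonoff and Banach-Alaoglu. The auxiliary radii turn the `ℓ²` bound on norms into closed
conditions, and the functionals are evaluated at `w i h`, a vector of `W`, so the compatibility
conditions are weak-star closed too. -/
theorem isCompact_decompositions (w : I → StrongDual ℂ W → W) :
    IsCompact (decompositions w) := by
  have hc1 : ∀ p, Continuous fun q : DecompositionSpace W I => (q p).1 :=
    fun p => (continuous_apply p).fst
  have hclosed : IsClosed (decompositions w) := by
    have e : decompositions w =
        (⋂ s : Finset (I × ℕ), {q | ∑ p ∈ s, (q p).1 ^ 2 ≤ 2 ^ 2}) ∩ ((⋂ p, {q | 0 ≤ (q p).1}) ∩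
        ((⋂ p, ⋂ x, {q | ‖(q p).2.1 x‖ ≤ (q p).1 * ‖x‖}) ∩
        ((⋂ p, ⋂ f, {q | ‖(q p).2.2 f‖ ≤ (q p).1 * ‖f‖}) ∩
        (⋂ i, ⋂ n, ⋂ h, {q | decompositionVal w q i n h = decompositionVal w q i 0 h})))) := by
      ext q
      simp only [decompositions, Set.mem_inter_iff, Set.mem_iInter]
      rfl
    rw [e]
    refine IsClosed.inter (isClosed_iInter fun s => isClosed_le
      (continuous_finsetSum _ fun p _ => (hc1 p).pow 2) continuous_const) ?_
    refine IsClosed.inter (isClosed_iInter fun p => isClosed_le continuous_const (hc1 p)) ?_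
    refine IsClosed.inter (isClosed_iInter fun p => isClosed_iInter fun x => isClosed_le
      ((WeakDual.eval_continuous x).comp (continuous_apply p).snd.fst).norm
      ((hc1 p).mul continuous_const)) ?_
    refine IsClosed.inter (isClosed_iInter fun p => isClosed_iInter fun f => isClosed_le
      ((WeakDual.eval_continuous f).comp (continuous_apply p).snd.snd).norm
      ((hc1 p).mul continuous_const)) ?_
    exact isClosed_iInter fun i => isClosed_iInter fun n => isClosed_iInter fun h =>
      isClosed_eq (continuous_decompositionVal w i n h) (continuous_decompositionVal w i 0 h)
  refine IsCompact.of_isClosed_subset (isCompact_univ_pi fun _ : I × ℕ =>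
    (isCompact_Icc (a := (0 : ℝ)) (b := 2)).prod
      ((WeakDual.isCompact_closedBall (0 : StrongDual ℂ W) 2).prod
        (WeakDual.isCompact_closedBall (0 : StrongDual ℂ (StrongDual ℂ W)) 2))) hclosed ?_
  rintro q ⟨h1, h2, h3, h4, -⟩ p -
  have h5 : (q p).1 ≤ 2 := by
    have := h1 {p}
    rw [Finset.sum_singleton] at this
    exact le_of_sq_le_sq this (by norm_num)
  refine ⟨⟨h2 p, h5⟩, ?_, ?_⟩
  · rw [Set.mem_preimage, mem_closedBall_zero_iff]
    exact ContinuousLinearMap.opNorm_le_bound _ (by norm_num) fun x =>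
      (h3 p x).trans (by gcongr)
  · rw [Set.mem_preimage, mem_closedBall_zero_iff]
    exact ContinuousLinearMap.opNorm_le_bound _ (by norm_num) fun x =>
      (h4 p x).trans (by gcongr)

variable {T : I → StrongDual ℂ W →L[ℂ] W}

/-- The bidual element represented lies within `2 · 2⁻ⁿ` of `2ⁿ T x ∈ W` for every `n`, so it
belongs to `W`. Solving for the second components puts them in `W` as well. -/
theorem exists_interpolation_of_decomposition [CompleteSpace W] {w : I → StrongDual ℂ W → W}
    (hw : ∀ i (h f : StrongDual ℂ W), h (T i f) = f (w i h)) {q : DecompositionSpace W I}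
    (hq : q ∈ decompositions w) :
    ∃ z : interpolation T, ∀ i h, h (interpolationCoord T i z) = decompositionVal w q i 0 h := by
  obtain ⟨h1, h2, h3, h4, h5⟩ := hq
  let κ := NormedSpace.inclusionInDoubleDual ℂ W
  have hκ : ∀ y h, κ y h = h y := fun y h => rfl
  have hκn : ∀ y, ‖κ y‖ = ‖y‖ := (NormedSpace.inclusionInDoubleDualLi (E := W) ℂ).norm_map
  let x : I × ℕ → StrongDual ℂ W := fun p => WeakDual.toStrongDual (q p).2.1
  let v : I × ℕ → StrongDual ℂ (StrongDual ℂ W) := fun p => WeakDual.toStrongDual (q p).2.2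
  have hx : ∀ p, ‖x p‖ ≤ (q p).1 := fun p =>
    ContinuousLinearMap.opNorm_le_bound _ (h2 p) (h3 p)
  have hv : ∀ p, ‖v p‖ ≤ (q p).1 := fun p =>
    ContinuousLinearMap.opNorm_le_bound _ (h2 p) (h4 p)
  have hle : ∀ p, (q p).1 ≤ 2 := fun p => by
    have := h1 {p}
    rw [Finset.sum_singleton] at this
    exact le_of_sq_le_sq this (by norm_num)
  let Φ : I → ℕ → StrongDual ℂ (StrongDual ℂ W) := fun i n =>
    (2 : ℂ) ^ n • κ (T i (x (i, n))) + ((2 : ℂ) ^ n)⁻¹ • v (i, n)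
  have hΦ : ∀ i n h, Φ i n h = decompositionVal w q i n h := fun i n h => by
    simp only [Φ, decompositionVal, add_apply, smul_apply, hκ, hw, smul_eq_mul]
    rfl
  have hΦ0 : ∀ i n, Φ i n = Φ i 0 := fun i n =>
    ContinuousLinearMap.ext fun h => by rw [hΦ, hΦ, h5]
  have hΦn : ∀ i n h, Φ i 0 h = (2 : ℂ) ^ n * h (T i (x (i, n))) + ((2 : ℂ) ^ n)⁻¹ * v (i, n) h :=
    fun i n h => by
      rw [← hΦ0 i n]
      simp only [Φ, add_apply, smul_apply, hκ, smul_eq_mul]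
  have hrange : ∀ i, ∃ y, κ y = Φ i 0 := by
    intro i
    refine exists_eq_of_forall_norm_sub_le (X := W) (Y := StrongDual ℂ (StrongDual ℂ W)) (κ := κ) hκn
      fun ε hε => ?_
    obtain ⟨n, hn⟩ := exists_pow_lt_of_lt_one (half_pos hε) (by norm_num : (2 : ℝ)⁻¹ < 1)
    refine ⟨(2 : ℂ) ^ n • T i (x (i, n)), ContinuousLinearMap.opNorm_le_bound _ hε.le fun h => ?_⟩
    have e : (Φ i 0 - κ ((2 : ℂ) ^ n • T i (x (i, n)))) h = ((2 : ℂ) ^ n)⁻¹ * v (i, n) h := by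
      rw [sub_apply, hΦn i n, hκ, map_smul, smul_eq_mul, add_sub_cancel_left]
    rw [e, norm_mul, norm_inv, norm_pow, Complex.norm_ofNat, ← inv_pow]
    have h6 : ‖v (i, n) h‖ ≤ 2 * ‖h‖ := (v (i, n)).le_of_opNorm_le ((hv _).trans (hle _)) h
    calc _ ≤ ε / 2 * (2 * ‖h‖) := by gcongr
      _ = ε * ‖h‖ := by ring
  choose y hy using hrange
  have h2n : ∀ n : ℕ, (2 : ℂ) ^ n ≠ 0 := fun n => pow_ne_zero n two_ne_zero
  let d : I × ℕ → W := fun p => (2 : ℂ) ^ p.2 • (y p.1 - (2 : ℂ) ^ p.2 • T p.1 (x p))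
  have hd : ∀ p, κ (d p) = v p := by
    rintro ⟨i, n⟩
    refine ContinuousLinearMap.ext fun h => ?_
    have h6 : h (y i) = _ := (DFunLike.congr_fun (hy i) h).trans (hΦn i n h)
    rw [hκ]
    simp only [d]
    rw [map_smul, map_sub, h6, map_smul, smul_eq_mul, smul_eq_mul, add_sub_cancel_left,
      mul_inv_cancel_left₀ (h2n n)]
  obtain ⟨z, hz, -⟩ := exists_interpolation_of_bound (T := T) y
    (fun p => slotMk (T p.1) p.2 (x p, d p)) (fun i n => by
      rw [slotVal_slotMk]
      simp only [d]
      rw [inv_smul_smul₀ (h2n n), add_sub_cancel]) (C := 2) (by norm_num) (fun s => by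
      refine le_trans (Finset.sum_le_sum fun p _ => ?_) (h1 s)
      gcongr
      refine (norm_slotMk_le _ _ _).trans ((norm_prod_le_iff (r := _)).2 ⟨hx p, ?_⟩)
      rw [← hκn, hd]
      exact hv p)
  refine ⟨z, fun i h => ?_⟩
  rw [hz, ← hκ, hy, hΦ]

/-- The hypothesis says that the transpose of each `T i` maps `W'` into `W`. Then the compact set of
decompositions covers the unit ball, and coordinate functionals are continuous on it. -/
theorem isReflexiveSpace_interpolation [CompleteSpace W]
    (hT : ∀ i (h : StrongDual ℂ W), ∃ w : W, ∀ f, h (T i f) = f w) :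
    IsReflexiveSpace (interpolation T) := by
  choose w hw using hT
  have : CompactSpace (decompositions w) :=
    isCompact_iff_compactSpace.1 (isCompact_decompositions w)
  choose θ hθ using fun q : decompositions w => exists_interpolation_of_decomposition hw q.2
  refine isReflexiveSpace_of_compact θ ?_ _ closure_span_coord_eq_top ?_
  · intro z hz
    rw [mem_closedBall_zero_iff] at hz
    choose v hv hv2 using fun p : I × ℕ => exists_slotMk_eq (T p.1) p.2 ((z : SlotSpace T) p)
    -- The doubled radius absorbs the choice of representatives; hence the constant `2 ^ 2` in
    -- `decompositions`.
    let q : DecompositionSpace W I := fun p => (2 * ‖(z : SlotSpace T) p‖,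
      StrongDual.toWeakDual (v p).1,
      StrongDual.toWeakDual (NormedSpace.inclusionInDoubleDual ℂ W (v p).2))
    have hval : ∀ i n h, decompositionVal w q i n h = h (interpolationCoord T i z) := by
      intro i n h
      rw [← slotVal_apply_eq_coord z i n, ← hv (i, n), slotVal_slotMk, map_add, map_smul,
        map_smul, hw]
      rfl
    have hq : q ∈ decompositions w := by
      refine ⟨fun s => ?_, fun p => by positivity, fun p x => ?_, fun p f => ?_, fun i n h => ?_⟩
      · have h1 := sum_norm_sq_le (z : SlotSpace T) s
        have h2 : ‖(z : SlotSpace T)‖ ^ 2 ≤ 1 := pow_le_one₀ (norm_nonneg _) hz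
        calc ∑ p ∈ s, (2 * ‖(z : SlotSpace T) p‖) ^ 2
            = 2 ^ 2 * ∑ p ∈ s, ‖(z : SlotSpace T) p‖ ^ 2 := by
              rw [Finset.mul_sum]
              exact Finset.sum_congr rfl fun p _ => by ring
          _ ≤ 2 ^ 2 := by linarith
      · exact (v p).1.le_of_opNorm_le ((norm_fst_le (v p)).trans (hv2 p)) x
      · change ‖f (v p).2‖ ≤ _
        rw [mul_comm]
        exact f.le_opNorm_of_le ((norm_snd_le (v p)).trans (hv2 p))
      · rw [hval, hval]
    refine ⟨⟨q, hq⟩, interpolation_ext fun i => ?_⟩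
    refine sub_eq_zero.1 (SeparatingDual.eq_zero_of_forall_dual_eq_zero (R := ℂ) fun h => ?_)
    rw [map_sub, hθ, hval, sub_self]
  · intro g hg
    induction hg using Submodule.span_induction with
    | mem g hg =>
      obtain ⟨i, h, rfl⟩ := hg
      simp only [ContinuousLinearMap.comp_apply, hθ]
      exact (continuous_decompositionVal w i 0 h).comp continuous_subtype_val
    | zero => simpa using continuous_const
    | add g k _ _ h1 h2 => exact h1.add h2
    | smul c g _ h => exact continuous_const.mul h

end InterpolationReflexive

/-! ### Vectors, actions and coefficients on the interpolation space -/

section InterpolationAction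

variable {W : Type u} [NormedAddCommGroup W] [NormedSpace ℂ W] {I : Type u}
  {T : I → StrongDual ℂ W →L[ℂ] W}

theorem exists_interpolation_vector (i : I) (f : StrongDual ℂ W) :
    ∃ z : interpolation T, interpolationCoord T i z = T i f ∧ ‖z‖ ≤ 2 * ‖f‖ := by
  classical
  have hn : ∀ n : ℕ, ‖slotMk (T i) n (((2 : ℂ) ^ n)⁻¹ • f, 0)‖ ≤ ((2 : ℝ) ^ n)⁻¹ * ‖f‖ := by
    intro n
    refine (norm_slotMk_le _ _ _).trans (le_of_eq ?_)
    simp [Prod.norm_def, norm_smul]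
  -- In slot `n` the vector `T i f` is represented by `(2⁻ⁿ f, 0)`; the squared norms are at most
  -- `2⁻ⁿ ‖f‖²`, with sum at most `2 ‖f‖² ≤ (2 ‖f‖)²`.
  let y : ∀ p : I × ℕ, Slot (T p.1) p.2 := fun p =>
    if p.1 = i then slotMk (T p.1) p.2 (((2 : ℂ) ^ p.2)⁻¹ • f, 0) else 0
  obtain ⟨z, hz, hzn⟩ := exists_interpolation_of_bound (T := T)
    (fun j => if j = i then T j f else 0) y (fun j n => by
      by_cases hj : j = i
      · simp [y, hj]
      · simp [y, hj]) (C := 2 * ‖f‖) (by positivity) (fun s => by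
      have hle : ∀ p : I × ℕ, ‖y p‖ ^ 2 ≤
          if p.1 = i then ((1 / 2 : ℝ) ^ p.2) * ‖f‖ ^ 2 else 0 := by
        rintro ⟨j, n⟩
        by_cases hj : j = i
        · subst hj
          simp only [y, if_true]
          calc _ ≤ (((2 : ℝ) ^ n)⁻¹ * ‖f‖) ^ 2 := by gcongr; exact hn n
            _ = ((1 / 2 : ℝ) ^ n) * ((1 / 2 : ℝ) ^ n) * ‖f‖ ^ 2 := by
              rw [one_div, inv_pow]; ring
            _ ≤ ((1 / 2 : ℝ) ^ n) * 1 * ‖f‖ ^ 2 := by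
              gcongr
              exact pow_le_one₀ (by norm_num) (by norm_num)
            _ = _ := by ring
        · simp [y, hj]
      refine (Finset.sum_le_sum fun p _ => hle p).trans ?_
      rw [← Finset.sum_filter]
      have hinj : Set.InjOn Prod.snd (s.filter fun p => p.1 = i : Set (I × ℕ)) := by
        rintro ⟨a, m⟩ ha ⟨b, n⟩ hb hab
        simp only [Finset.coe_filter, Set.mem_ofPred_eq] at ha hb
        exact Prod.ext (ha.2.trans hb.2.symm) hab
      rw [← Finset.sum_mul,
        ← Finset.sum_image (f := fun n : ℕ => (1 / 2 : ℝ) ^ n) (g := Prod.snd) hinj]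
      have h1 := (summable_geometric_two).sum_le_tsum
        ((s.filter fun p => p.1 = i).image Prod.snd) (fun n _ => by positivity)
      rw [tsum_geometric_two] at h1
      nlinarith [sq_nonneg ‖f‖])
  exact ⟨z, by rw [hz, if_pos rfl], hzn⟩

variable {A : Type u} [NormedAddCommGroup A] [NormedSpace ℂ A]

theorem exists_interpolation_action (L : A →L[ℂ] W →L[ℂ] W) (R : A → W →L[ℂ] W) {C : ℝ}
    (hC : 0 ≤ C) (hL : ∀ a, ‖L a‖ ≤ C * ‖a‖) (hR : ∀ a, ‖R a‖ ≤ C * ‖a‖)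
    (hLR : ∀ i a f, T i (f.comp (R a)) = L a (T i f)) :
    ∃ ρ : A →L[ℂ] interpolation T →L[ℂ] interpolation T,
      ∀ a z i, interpolationCoord T i (ρ a z) = L a (interpolationCoord T i z) := by
  have key : ∀ (a : A) (z : interpolation T), ∃ z' : interpolation T,
      (∀ i, interpolationCoord T i z' = L a (interpolationCoord T i z)) ∧
        ‖z'‖ ≤ 2 * C * ‖a‖ * ‖z‖ := by
    intro a z
    refine exists_interpolation_of_bound _
      (fun p => slotSec (T p.1) p.2 (L a (slotVal (T p.1) p.2 ((z : SlotSpace T) p))))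
      (fun i n => by rw [slotVal_slotSec, slotVal_apply_eq_coord]) (by positivity) fun s => ?_
    calc _ ≤ ∑ p ∈ s, (2 * C * ‖a‖) ^ 2 * ‖(z : SlotSpace T) p‖ ^ 2 := by
          refine Finset.sum_le_sum fun p _ => ?_
          rw [← mul_pow]
          gcongr
          rw [mul_assoc 2 C]
          exact norm_slotSec_le _ _ (hLR p.1 a) (hR a) (hL a) _
      _ ≤ (2 * C * ‖a‖) ^ 2 * ‖z‖ ^ 2 := by
          rw [← Finset.mul_sum]
          gcongr
          exact sum_norm_sq_le (z : SlotSpace T) s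
      _ = _ := by ring
  choose act hact hnorm using key
  refine ⟨LinearMap.mkContinuous₂ (LinearMap.mk₂ ℂ act ?_ ?_ ?_ ?_) (2 * C) hnorm,
    fun a z i => hact a z i⟩
  · intro a b z; exact interpolation_ext fun i => by simp [hact]
  · intro c a z; exact interpolation_ext fun i => by simp [hact]
  · intro a z z'; exact interpolation_ext fun i => by simp [hact]
  · intro c a z; exact interpolation_ext fun i => by simp [hact]

/-- Coefficients of the action lie in every closed subspace containing the coefficients of `L`. -/
theorem interpolation_coefficient_mem {P : Submodule ℂ (StrongDual ℂ A)}
    (hP : IsClosed (P : Set (StrongDual ℂ A))) {L : A →L[ℂ] W →L[ℂ] W}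
    (hL : ∀ (h : StrongDual ℂ W) (w : W), ∃ μ ∈ P, ∀ a, h (L a w) = μ a)
    {ρ : A →L[ℂ] interpolation T →L[ℂ] interpolation T}
    (hρ : ∀ a z i, interpolationCoord T i (ρ a z) = L a (interpolationCoord T i z))
    (l : StrongDual ℂ (interpolation T)) (z : interpolation T) :
    ∃ μ ∈ P, ∀ a, l (ρ a z) = μ a := by
  let V : StrongDual ℂ (interpolation T) →L[ℂ] StrongDual ℂ A :=
    ContinuousLinearMap.precomp ℂ (ρ.flip z)
  have hl : l ∈ (Submodule.span ℂ {g : StrongDual ℂ (interpolation T) |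
      ∃ (i : I) (h : StrongDual ℂ W), g = h.comp (interpolationCoord T i)}).topologicalClosure :=
    closure_span_coord_eq_top (T := T) ▸ Submodule.mem_top
  have hsub : Submodule.span ℂ {g : StrongDual ℂ (interpolation T) |
      ∃ (i : I) (h : StrongDual ℂ W), g = h.comp (interpolationCoord T i)} ≤
      P.comap V.toLinearMap := by
    rw [Submodule.span_le]
    rintro _ ⟨i, h, rfl⟩
    obtain ⟨μ, hμ, e⟩ := hL h (interpolationCoord T i z)
    have : V (h.comp (interpolationCoord T i)) = μ := by
      ext a
      rw [← e, ← hρ]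
      rfl
    change V (h.comp (interpolationCoord T i)) ∈ P
    rwa [this]
  have hcl : IsClosed (P.comap V.toLinearMap : Set (StrongDual ℂ (interpolation T))) :=
    hP.preimage V.continuous
  exact ⟨V l, closure_minimal hsub hcl hl, fun a => rfl⟩

end InterpolationAction

/-! ### The predual of the unitization and its orbit maps -/

section Predual

variable {A : Type u} [NonUnitalNormedRing A] [NormedSpace ℂ A] {P : Submodule ℂ (StrongDual ℂ A)}

/-- A subspace of the dual, as a Banach space in its own right. -/
def Predual (P : Submodule ℂ (StrongDual ℂ A)) : Type u := P

namespace Predual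

noncomputable instance : NormedAddCommGroup (Predual P) := inferInstanceAs (NormedAddCommGroup P)

noncomputable instance : NormedSpace ℂ (Predual P) := inferInstanceAs (NormedSpace ℂ P)

variable (P) in
/-- The inclusion into the dual. -/
noncomputable def toDual : Predual P →L[ℂ] StrongDual ℂ A := P.subtypeL

/-- An element of the subspace, as an element of `Predual P`. -/
def ofMem (μ : StrongDual ℂ A) (hμ : μ ∈ P) : Predual P := (⟨μ, hμ⟩ : P)

@[simp]
theorem toDual_ofMem (μ : StrongDual ℂ A) (hμ : μ ∈ P) : toDual P (ofMem μ hμ) = μ := rfl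

theorem toDual_mem (v : Predual P) : toDual P v ∈ P := Subtype.property (p := (· ∈ P)) v

@[ext]
theorem ext {v w : Predual P} (h : ∀ a, toDual P v a = toDual P w a) : v = w :=
  Subtype.ext (p := (· ∈ P)) (ContinuousLinearMap.ext h)

theorem completeSpace (hP : IsClosed (P : Set (StrongDual ℂ A))) : CompleteSpace (Predual P) :=
  hP.completeSpace_coe

variable (P) in
/-- Evaluation at an element of `A`. -/
noncomputable def eval : A →L[ℂ] StrongDual ℂ (Predual P) := (toDual P).flip

@[simp]
theorem eval_apply (a : A) (v : Predual P) : eval P a v = toDual P v a := rfl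

end Predual

end Predual

section DualBanachAlgebra

variable {A : Type u} [NonUnitalNormedRing A] [NormedSpace ℂ A] [IsScalarTower ℂ A A]
  [SMulCommClass ℂ A A] {P : Submodule ℂ (StrongDual ℂ A)}

@[simp]
theorem dualLeftAct_apply (a : A) (μ : StrongDual ℂ A) (b : A) : dualLeftAct a μ b = μ (b * a) :=
  rfl

@[simp]
theorem dualRightAct_apply (a : A) (μ : StrongDual ℂ A) (b : A) :
    dualRightAct μ a b = μ (a * b) := rfl

theorem norm_dualLeftAct_le (a : A) (μ : StrongDual ℂ A) : ‖dualLeftAct a μ‖ ≤ ‖a‖ * ‖μ‖ :=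
  ContinuousLinearMap.opNorm_le_bound _ (by positivity) fun b => by
    rw [dualLeftAct_apply]
    calc _ ≤ ‖μ‖ * (‖b‖ * ‖a‖) := μ.le_opNorm_of_le (norm_mul_le b a)
      _ = _ := by ring

theorem norm_dualRightAct_le (a : A) (μ : StrongDual ℂ A) : ‖dualRightAct μ a‖ ≤ ‖a‖ * ‖μ‖ :=
  ContinuousLinearMap.opNorm_le_bound _ (by positivity) fun b => by
    rw [dualRightAct_apply]
    calc _ ≤ ‖μ‖ * (‖a‖ * ‖b‖) := μ.le_opNorm_of_le (norm_mul_le a b)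
      _ = _ := by ring

namespace Predual

theorem eval_bijective (hP : IsDualBanachAlgebra P) : Function.Bijective (eval P) := by
  constructor
  · intro a b h
    exact hP.bijective.1 (ContinuousLinearMap.ext fun μ => DFunLike.congr_fun h (ofMem μ.1 μ.2))
  · intro f
    let g : StrongDual ℂ P :=
      { toFun := fun μ => f (ofMem μ.1 μ.2)
        map_add' := fun μ ν => map_add f (ofMem μ.1 μ.2) (ofMem ν.1 ν.2)
        map_smul' := fun k μ => map_smul f k (ofMem μ.1 μ.2)
        cont := f.continuous }
    obtain ⟨a, ha⟩ := hP.bijective.2 g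
    exact ⟨a, ContinuousLinearMap.ext fun v => DFunLike.congr_fun ha ⟨toDual P v, toDual_mem v⟩⟩

end Predual

namespace IsDualBanachAlgebra

open Predual

theorem bounded_below [CompleteSpace A] (hP : IsDualBanachAlgebra P) :
    ∃ K > 0, ∀ a, ‖a‖ ≤ K * ‖eval P a‖ := by
  let e := ContinuousLinearEquiv.ofBijective (eval P)
    (LinearMap.ker_eq_bot.2 (eval_bijective hP).1) (LinearMap.range_eq_top.2 (eval_bijective hP).2)
  refine ⟨‖(e.symm : StrongDual ℂ (Predual P) →L[ℂ] A)‖ + 1, by positivity, fun a => ?_⟩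
  have h1 := (e.symm : StrongDual ℂ (Predual P) →L[ℂ] A).le_opNorm (eval P a)
  have h2 : (e.symm : StrongDual ℂ (Predual P) →L[ℂ] A) (eval P a) = a := e.symm_apply_apply a
  rw [h2] at h1
  linarith [norm_nonneg (eval P a)]

/-- The left action of `A` on the predual `P × ℂ` of the unitization of `A`. -/
noncomputable def leftAction (hP : IsDualBanachAlgebra P) :
    A →L[ℂ] (Predual P × ℂ) →L[ℂ] (Predual P × ℂ) :=
  LinearMap.mkContinuous₂ (LinearMap.mk₂ ℂ
    (fun a (v : Predual P × ℂ) =>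
      ((ofMem (dualLeftAct a (toDual P v.1)) (hP.left_mem a _ (toDual_mem v.1)),
        toDual P v.1 a) : Predual P × ℂ))
    (fun a b v => by
      refine Prod.ext (Predual.ext fun c => ?_) ?_
      · simp [mul_add]
      · simp)
    (fun k a v => by
      refine Prod.ext (Predual.ext fun c => ?_) ?_
      · simp [mul_smul_comm]
      · simp)
    (fun a v w => by
      refine Prod.ext (Predual.ext fun c => ?_) ?_
      · simp
      · simp)
    (fun k a v => by
      refine Prod.ext (Predual.ext fun c => ?_) ?_
      · simp
      · simp)) 1 (fun a v => by
    have h1 : ‖v.1‖ ≤ ‖v‖ := norm_fst_le v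
    rw [one_mul]
    refine (norm_prod_le_iff (r := _)).2
      ⟨(norm_dualLeftAct_le a (toDual P v.1)).trans (by gcongr; exact h1), ?_⟩
    rw [mul_comm]
    exact (toDual P v.1).le_of_opNorm_le h1 a)

/-- The right action of `A` on the predual `P × ℂ` of the unitization of `A`. -/
noncomputable def rightAction (hP : IsDualBanachAlgebra P) :
    A →L[ℂ] (Predual P × ℂ) →L[ℂ] (Predual P × ℂ) :=
  LinearMap.mkContinuous₂ (LinearMap.mk₂ ℂ
    (fun a (v : Predual P × ℂ) =>
      ((ofMem (dualRightAct (toDual P v.1) a) (hP.right_mem a _ (toDual_mem v.1)),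
        toDual P v.1 a) : Predual P × ℂ))
    (fun a b v => by
      refine Prod.ext (Predual.ext fun c => ?_) ?_
      · simp [add_mul]
      · simp)
    (fun k a v => by
      refine Prod.ext (Predual.ext fun c => ?_) ?_
      · simp [smul_mul_assoc]
      · simp)
    (fun a v w => by
      refine Prod.ext (Predual.ext fun c => ?_) ?_
      · simp
      · simp)
    (fun k a v => by
      refine Prod.ext (Predual.ext fun c => ?_) ?_
      · simp
      · simp)) 1 (fun a v => by
    have h1 : ‖v.1‖ ≤ ‖v‖ := norm_fst_le v
    rw [one_mul]
    refine (norm_prod_le_iff (r := _)).2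
      ⟨(norm_dualRightAct_le a (toDual P v.1)).trans (by gcongr; exact h1), ?_⟩
    rw [mul_comm]
    exact (toDual P v.1).le_of_opNorm_le h1 a)

theorem leftAction_fst (hP : IsDualBanachAlgebra P) (a : A) (v : Predual P × ℂ) (b : A) :
    toDual P (hP.leftAction a v).1 b = toDual P v.1 (b * a) := rfl

theorem leftAction_snd (hP : IsDualBanachAlgebra P) (a : A) (v : Predual P × ℂ) :
    (hP.leftAction a v).2 = toDual P v.1 a := rfl

theorem rightAction_fst (hP : IsDualBanachAlgebra P) (a : A) (v : Predual P × ℂ) (b : A) :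
    toDual P (hP.rightAction a v).1 b = toDual P v.1 (a * b) := rfl

theorem rightAction_snd (hP : IsDualBanachAlgebra P) (a : A) (v : Predual P × ℂ) :
    (hP.rightAction a v).2 = toDual P v.1 a := rfl

theorem norm_leftAction_le (hP : IsDualBanachAlgebra P) (a : A) : ‖hP.leftAction a‖ ≤ 1 * ‖a‖ :=
  (hP.leftAction).le_of_opNorm_le (LinearMap.mkContinuous₂_norm_le _ zero_le_one _) a

theorem norm_rightAction_le (hP : IsDualBanachAlgebra P) (a : A) : ‖hP.rightAction a‖ ≤ 1 * ‖a‖ :=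
  (hP.rightAction).le_of_opNorm_le (LinearMap.mkContinuous₂_norm_le _ zero_le_one _) a

theorem leftAction_mul (hP : IsDualBanachAlgebra P) (a b : A) (v : Predual P × ℂ) :
    hP.leftAction (a * b) v = hP.leftAction a (hP.leftAction b v) := by
  refine Prod.ext (Predual.ext fun c => ?_) ?_
  · simp only [leftAction_fst, mul_assoc]
  · simp only [leftAction_fst, leftAction_snd]

theorem rightAction_mul (hP : IsDualBanachAlgebra P) (a b : A) (v : Predual P × ℂ) :
    hP.rightAction (a * b) v = hP.rightAction b (hP.rightAction a v) := by
  refine Prod.ext (Predual.ext fun c => ?_) ?_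
  · simp only [rightAction_fst, mul_assoc]
  · simp only [rightAction_fst, rightAction_snd]

theorem exists_functional_eq (hP : IsDualBanachAlgebra P) (f : StrongDual ℂ (Predual P × ℂ)) :
    ∃ (b : A) (k : ℂ), ∀ v : Predual P × ℂ, f v = toDual P v.1 b + k * v.2 := by
  obtain ⟨b, hb⟩ := hP.bijective.2 (f.comp (ContinuousLinearMap.inl ℂ (Predual P) ℂ))
  refine ⟨b, f (0, 1), fun v => ?_⟩
  have h1 : toDual P v.1 b = f (v.1, 0) := DFunLike.congr_fun hb v.1
  have h2 : v = (v.1, 0) + v.2 • ((0, 1) : Predual P × ℂ) := by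
    refine Prod.ext ?_ ?_ <;> simp
  rw [h1]
  conv_lhs => rw [h2]
  rw [map_add, map_smul, smul_eq_mul, mul_comm]

theorem orbit_mem (hP : IsDualBanachAlgebra P) (μ : Predual P) (f : StrongDual ℂ (Predual P × ℂ)) :
    f.comp (hP.rightAction.flip (μ, 0)) ∈ P := by
  obtain ⟨b, k, hf⟩ := hP.exists_functional_eq f
  have : f.comp (hP.rightAction.flip (μ, 0)) = dualLeftAct b (toDual P μ) + k • toDual P μ := by
    refine ContinuousLinearMap.ext fun c => ?_
    rw [ContinuousLinearMap.comp_apply, hf]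
    rfl
  rw [this]
  exact P.add_mem (hP.left_mem b _ (toDual_mem μ)) (P.smul_mem _ (toDual_mem μ))

/-- The orbit map of `(μ, 0)` for the action of the unitization of `A`, identified with the dual of
`P × ℂ`. -/
noncomputable def orbit (hP : IsDualBanachAlgebra P) (μ : Predual P) :
    StrongDual ℂ (Predual P × ℂ) →L[ℂ] Predual P × ℂ :=
  LinearMap.mkContinuous
    { toFun := fun f => (ofMem (f.comp (hP.rightAction.flip (μ, 0))) (hP.orbit_mem μ f), f (μ, 0))
      map_add' := fun f g => by
        refine Prod.ext (Predual.ext fun c => ?_) ?_ <;> simp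
      map_smul' := fun k f => by
        refine Prod.ext (Predual.ext fun c => ?_) ?_ <;> simp } ‖μ‖
    fun f => by
      have hμ : ‖((μ, 0) : Predual P × ℂ)‖ = ‖μ‖ := by simp [Prod.norm_def]
      refine (norm_prod_le_iff (r := _)).2 ⟨?_, ?_⟩
      · refine ContinuousLinearMap.opNorm_le_bound _ (by positivity) fun c => ?_
        change ‖f (hP.rightAction c (μ, 0))‖ ≤ _
        have h1 := (hP.rightAction c).le_of_opNorm_le (hP.norm_rightAction_le c) (μ, 0)
        rw [hμ] at h1
        calc _ ≤ ‖f‖ * (1 * ‖c‖ * ‖μ‖) := f.le_opNorm_of_le h1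
          _ = _ := by ring
      · rw [mul_comm]
        exact f.le_opNorm_of_le hμ.le

theorem orbit_fst (hP : IsDualBanachAlgebra P) (μ : Predual P)
    (f : StrongDual ℂ (Predual P × ℂ)) (c : A) :
    toDual P (hP.orbit μ f).1 c = f (hP.rightAction c (μ, 0)) := rfl

theorem orbit_snd (hP : IsDualBanachAlgebra P) (μ : Predual P)
    (f : StrongDual ℂ (Predual P × ℂ)) : (hP.orbit μ f).2 = f (μ, 0) := rfl

theorem norm_orbit_le (hP : IsDualBanachAlgebra P) (μ : Predual P) : ‖hP.orbit μ‖ ≤ ‖μ‖ :=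
  LinearMap.mkContinuous_norm_le _ (norm_nonneg μ) _

/-- The projection to `ℂ` is the unit of the unitization. Adjoining it ensures that `(μ, 0)` lies in
the range of its own orbit map. -/
theorem orbit_snd_functional (hP : IsDualBanachAlgebra P) (μ : Predual P) :
    hP.orbit μ (ContinuousLinearMap.snd ℂ (Predual P) ℂ) = (μ, 0) := by
  refine Prod.ext (Predual.ext fun c => ?_) ?_
  · rfl
  · rfl

/-- Associativity `(a f) · μ = a · (f · μ)`: precomposing `f` with the right action of `a` is
multiplication by `a` in the unitization. -/
theorem orbit_comp (hP : IsDualBanachAlgebra P) (μ : Predual P) (a : A)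
    (f : StrongDual ℂ (Predual P × ℂ)) :
    hP.orbit μ (f.comp (hP.rightAction a)) = hP.leftAction a (hP.orbit μ f) := by
  refine Prod.ext (Predual.ext fun c => ?_) ?_
  · rw [leftAction_fst, orbit_fst, orbit_fst, rightAction_mul]
    rfl
  · rw [leftAction_snd, orbit_fst, orbit_snd]
    rfl

/-- The weak compactness needed for interpolation: moving the right action onto `μ` keeps it in `P`,
so the transpose of the orbit map takes values in `W`. -/
theorem exists_orbit_eval (hP : IsDualBanachAlgebra P) (μ : Predual P)
    (h : StrongDual ℂ (Predual P × ℂ)) :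
    ∃ w : Predual P × ℂ, ∀ f, h (hP.orbit μ f) = f w := by
  obtain ⟨c, k, hk⟩ := hP.exists_functional_eq h
  refine ⟨hP.rightAction c (μ, 0) + k • (μ, 0), fun f => ?_⟩
  rw [hk, orbit_fst, orbit_snd, map_add, map_smul, smul_eq_mul]

theorem leftAction_coefficient_mem (hP : IsDualBanachAlgebra P)
    (h : StrongDual ℂ (Predual P × ℂ)) (w : Predual P × ℂ) :
    ∃ μ ∈ P, ∀ a, h (hP.leftAction a w) = μ a := by
  obtain ⟨c, k, hk⟩ := hP.exists_functional_eq h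
  refine ⟨dualRightAct (toDual P w.1) c + k • toDual P w.1,
    P.add_mem (hP.right_mem c _ (toDual_mem w.1)) (P.smul_mem _ (toDual_mem w.1)), fun a => ?_⟩
  rw [hk, leftAction_fst, leftAction_snd]
  rfl

/-- A dual Banach algebra has a bounded-below, weak-star continuous representation on a reflexive
Banach space. -/
theorem exists_reflexive_representation [CompleteSpace A] (hP : IsDualBanachAlgebra P) :
    ∃ (F : Type u) (_ : NormedAddCommGroup F) (_ : NormedSpace ℂ F) (_ : CompleteSpace F)
      (ρ : A →L[ℂ] F →L[ℂ] F) (r : ℝ), IsReflexiveSpace F ∧ (∀ a b, ρ (a * b) = ρ a * ρ b) ∧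
      0 < r ∧ (∀ a, r * ‖a‖ ≤ ‖ρ a‖) ∧
      ∀ (l : StrongDual ℂ F) (x : F), ∃ μ ∈ P, ∀ a, l (ρ a x) = μ a := by
  have : CompleteSpace (Predual P) := completeSpace hP.isClosed
  -- Restricting to the unit ball keeps the coordinate maps uniformly bounded.
  let T : {μ : Predual P // ‖μ‖ ≤ 1} → StrongDual ℂ (Predual P × ℂ) →L[ℂ] Predual P × ℂ :=
    fun μ => hP.orbit μ.1
  obtain ⟨ρ, hρ⟩ := exists_interpolation_action (T := T) hP.leftAction hP.rightAction
    zero_le_one hP.norm_leftAction_le hP.norm_rightAction_le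
    (fun μ a f => hP.orbit_comp μ.1 a f)
  obtain ⟨K, hK, hbelow⟩ := hP.bounded_below
  -- The vector with coordinate `(μ, 0)` is moved by `a` to one with coordinate `(a · μ, ⟨μ, a⟩)`,
  -- so `ρ a` recovers `⟨μ, a⟩`. The 8 is the coordinate bound 4 times the vector's norm bound 2.
  have hle : ∀ a, ‖eval P a‖ ≤ 8 * ‖ρ a‖ := by
    intro a
    refine ContinuousLinearMap.opNorm_le_of_unit_norm (𝕜 := ℂ) (by positivity) fun μ hμ => ?_
    let i : {μ : Predual P // ‖μ‖ ≤ 1} := ⟨μ, hμ.le⟩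
    obtain ⟨z, hz, hzn⟩ := exists_interpolation_vector (T := T) i
      (ContinuousLinearMap.snd ℂ (Predual P) ℂ)
    have hsnd : ‖ContinuousLinearMap.snd ℂ (Predual P) ℂ‖ ≤ 1 :=
      ContinuousLinearMap.norm_snd_le _ _ _
    have hTi : ‖T i‖ ≤ 1 := (hP.norm_orbit_le μ).trans hμ.le
    have e : eval P a μ = (interpolationCoord T i (ρ a z)).2 := by
      rw [hρ, hz, leftAction_snd]
      change _ = toDual P (hP.orbit μ (ContinuousLinearMap.snd ℂ (Predual P) ℂ)).1 a
      rw [orbit_snd_functional]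
      rfl
    rw [e]
    calc ‖(interpolationCoord T i (ρ a z)).2‖ ≤ ‖interpolationCoord T i (ρ a z)‖ := norm_snd_le _
      _ ≤ 2 * (‖T i‖ + 1) * ‖ρ a z‖ := norm_interpolationCoord_le i _
      _ ≤ 2 * (1 + 1) * (‖ρ a‖ * (2 * 1)) := by
        gcongr
        exact (ρ a).le_opNorm_of_le (hzn.trans (by gcongr))
      _ = 8 * ‖ρ a‖ := by ring
  refine ⟨interpolation T, inferInstance, inferInstance, inferInstance, ρ, (8 * K)⁻¹,
    isReflexiveSpace_interpolation fun i h => hP.exists_orbit_eval i.1 h, fun a b => ?_,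
    by positivity, fun a => ?_,
    interpolation_coefficient_mem hP.isClosed hP.leftAction_coefficient_mem hρ⟩
  · refine ContinuousLinearMap.ext fun z => interpolation_ext fun i => ?_
    rw [mul_apply_eq_comp, hρ, hρ, hρ, leftAction_mul]
  · rw [inv_mul_le_iff₀ (by positivity)]
    calc ‖a‖ ≤ K * ‖eval P a‖ := hbelow a
      _ ≤ K * (8 * ‖ρ a‖) := by gcongr; exact hle a
      _ = _ := by ring

end IsDualBanachAlgebra

end DualBanachAlgebra

theorem mainTheorem7 {A : Type u} [NonUnitalNormedRing A] [NormedSpace ℂ A]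
    [IsScalarTower ℂ A A] [SMulCommClass ℂ A A] [CompleteSpace A]
    [StarRing A] [StarModule ℂ A] [ContinuousStar A]
    (P : Submodule ℂ (StrongDual ℂ A)) (hP : IsDualBanachAlgebra P) :
    List.TFAE [
      -- the involution is weak-star continuous
      Continuous[weakStarTopology (P : Set (StrongDual ℂ A)),
        weakStarTopology (P : Set (StrongDual ℂ A))] (fun a : A => star a),
      -- `A` is weak-star continuously *-isomorphic to a closed subalgebra of `B(E)`, where `E` is
      -- reflexive and `B(E)` carries some continuous involution
      ∃ (E : Type u) (_ : NormedAddCommGroup E) (_ : NormedSpace ℂ E) (_ : CompleteSpace E)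
        (_ : StarRing (E →L[ℂ] E)) (_ : StarModule ℂ (E →L[ℂ] E))
        (_ : ContinuousStar (E →L[ℂ] E)) (π : A →⋆ₙₐ[ℂ] (E →L[ℂ] E)),
        IsReflexiveSpace E ∧
        Topology.IsClosedEmbedding (fun a : A => π a) ∧
        Continuous[weakStarTopology (P : Set (StrongDual ℂ A)),
          weakStarTopology (operatorPredual E)] (fun a : A => π a),
      -- the same, where the involution of `B(E)` comes from a bounded sesquilinear form
      -- `[x, y] = J y x` whose induced conjugate-linear map `J : E → E'` is a homeomorphism
      ∃ (E : Type u) (_ : NormedAddCommGroup E) (_ : NormedSpace ℂ E) (_ : CompleteSpace E)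
        (_ : StarRing (E →L[ℂ] E)) (_ : StarModule ℂ (E →L[ℂ] E))
        (_ : ContinuousStar (E →L[ℂ] E)) (π : A →⋆ₙₐ[ℂ] (E →L[ℂ] E))
        (J : E →L⋆[ℂ] StrongDual ℂ E),
        IsReflexiveSpace E ∧
        IsHomeomorph (fun y : E => J y) ∧
        (∀ (T : E →L[ℂ] E) (x y : E), J y ((star T) x) = J (T y) x) ∧
        Topology.IsClosedEmbedding (fun a : A => π a) ∧
        Continuous[weakStarTopology (P : Set (StrongDual ℂ A)),
          weakStarTopology (operatorPredual E)] (fun a : A => π a)] := by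
  tfae_have 1 → 3 := by
    intro h
    obtain ⟨F, _, _, _, ρ, r, hF, hmul, hr, hbelow, hρ⟩ := hP.exists_reflexive_representation
    exact exists_involutive_representation hP.isClosed ((continuous_star_weakStar_iff P).1 h)
      -- The second summand is the conjugate dual of `F`, so its identification with `F'` is
      -- conjugate-linear, as the form requires.
      (antidualEquiv (F := F)) hF ρ hmul hr hbelow hρ
  tfae_have 3 → 2 := by
    rintro ⟨E, i1, i2, i3, i4, i5, i6, π, J, hE, -, -, hc, hw⟩
    exact ⟨E, i1, i2, i3, i4, i5, i6, π, hE, hc, hw⟩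
  tfae_have 2 → 1 := by
    rintro ⟨E, _, _, _, _, _, _, π, -, hc, hw⟩
    exact continuous_star_weakStar_of_representation hP π hc.injective hw
  tfae_finish
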